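/- Let $\Lambda$ be an artin algebra, i.e. an algebra over a commutative artinian ring $R$ that is finitely generated as an $R$-module, and let $\mathrm{mod}\,\Lambda$ be the category of finitely generated left $\Lambda$-modules. Let $\mathfrak{A}$ be a strong idempotent ideal of $\Lambda$: a two-sided ideal with $\mathfrak{A}^2=\mathfrak{A}$ such that, for all $X,Y\in\mathrm{mod}\,\Lambda/\mathfrak{A}$ and all $i\ge 0$, the canonical map $\mathrm{Ext}^i_{\Lambda/\mathfrak{A}}(X,Y)\to\mathrm{Ext}^i_{\Lambda}(X,Y)$ is an isomorphism. Let $P$ be a finitely generated projective $\Lambda$-module whose trace in $\Lambda$ (the sum of the images of all homomorphisms $P\to\Lambda$) is $\mathfrak{A}$, and let $\Gamma=\mathrm{End}_\Lambda(P)^{op}$. For an artin algebra $B$, let $K_0$ be the abelian group generated by the symbols $[M]$, $M\in\mathrm{mod}\,B$, subject to $[C]=[A]+[A']$ if $C\cong A\oplus A'$, and $[I]=0$ if $I$ is injective; let $\Omega^{-1}:K_0\to K_0$ be the homomorphism $[M]\mapsto[\Omega^{-1}(M)]$, where $\Omega^{-1}(M)$ is the cokernel of an injective envelope of $M$; and let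 $\langle\mathrm{add}\,M\rangle\subseteq K_0$ be the subgroup generated by the classes of the indecomposable direct summands of $M$. Let $\phi_r(M)$ be the least integer $n\ge 0$ such that $\Omega^{-1}$ restricts to an isomorphism $\Omega^{-s}\langle\mathrm{add}\,M\rangle\to\Omega^{-(s+1)}\langle\mathrm{add}\,M\rangle$ for all $s\ge n$, and let $\phi_r\dim(B)=\sup\{\phi_r(M): M\in\mathrm{mod}\,B\}$. Let $\mathrm{gld}(\Gamma)$ denote the global dimension of $\Gamma$ (the supremum of the projective dimensions of its finitely generated left modules), and let $\mathrm{pd}_\Lambda(\Lambda/\mathfrak{A})$ and $\mathrm{pd}(\Lambda/\mathfrak{A})_\Lambda$ be the projective dimensions of $\Lambda/\mathfrak{A}$ as a left and as a right $\Lambda$-module, with the convention that the zero module has projective dimension $0$. Then, as an inequality in $\mathbb{N}\cup\{\infty\}$, $$\phi_r\dim(\Lambda)\ \le\ \mathrm{pd}_\Lambda(\Lambda/\mathfrak{A})+\max\{\,\mathrm{gld}(\Gamma)+1,\ \mathrm{pd}(\Lambda/\mathfrak{A})_\Lambda+\phi_r\dim(\Lambda/\mathfrak{A})\,\}.$$ 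-/

import Mathlib

universe u w

/-- `f : M → E` is an injective envelope of `M`: `E` is an injective module, `f` is injective, and
`f(M)` is essential in `E` (it meets every nonzero submodule of `E`). -/
structure IsInjectiveEnvelope {Λ : Type u} [Ring Λ] {M E : Type u} [AddCommGroup M] [Module Λ M]
    [AddCommGroup E] [Module Λ E] (f : M →ₗ[Λ] E) : Prop where
  injective_module : Module.Injective Λ E
  injective : Function.Injective f
  essential : ∀ N : Submodule Λ E, N ⊓ LinearMap.range f = ⊥ → N = ⊥

theorem exists_essential_injective_le {Λ : Type u} [Ring Λ] {Q : Type u} [AddCommGroup Q]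
    [Module Λ Q] [Module.Injective Λ Q] (M : Submodule Λ Q) :
    ∃ E : Submodule Λ Q, M ≤ E ∧ (∀ N ≤ E, N ⊓ M = ⊥ → N = ⊥) ∧ Module.Injective Λ E := by
  obtain ⟨E, hME, hmax⟩ := zorn_le_nonempty₀
    {E : Submodule Λ Q | M ≤ E ∧ ∀ N ≤ E, N ⊓ M = ⊥ → N = ⊥} (by
      intro c hc hchain y hy
      refine ⟨sSup c, ⟨(hc hy).1.trans (le_sSup hy), ?_⟩, fun z hz => le_sSup hz⟩
      intro N hN hNM
      rw [Submodule.eq_bot_iff]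
      intro x hx
      obtain ⟨E, hE, hxE⟩ := (Submodule.mem_sSup_of_directed ⟨y, hy⟩ hchain.directedOn).1 (hN hx)
      have h1 := (hc hE).2 (Submodule.span Λ {x}) (by simpa using hxE)
        (le_bot_iff.1 (hNM ▸ inf_le_inf_right M (by simpa using hx)))
      simpa using h1) M ⟨le_rfl, fun N hN h => by rwa [inf_eq_left.2 hN] at h⟩
  obtain ⟨K, -, hK⟩ := zorn_le_nonempty₀ {K : Submodule Λ Q | Disjoint K E} (by
      intro c hc hchain y hy
      refine ⟨sSup c, ?_, fun z hz => le_sSup hz⟩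
      exact (DirectedOn.disjoint_sSup_left hchain.directedOn).2 fun a ha => hc ha)
    ⊥ disjoint_bot_left
  have hKE : Disjoint K E := hK.prop
  have hE := hmax.prop
  have key : ∀ K' : Submodule Λ Q, K ≤ K' → (∀ e ∈ E, e ∈ K' → e = 0) → K' ≤ K := by
    intro K' h1 h2
    exact hK.le_of_ge (Submodule.disjoint_def.2 fun x hx hxE => h2 x hxE hx) h1
  obtain ⟨h, hh⟩ := Module.Injective.out (R := Λ) (Q := Q) (K.mkQ ∘ₗ E.subtype) (by
    rw [← LinearMap.ker_eq_bot, Submodule.eq_bot_iff]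
    intro x hx
    have : (x : Q) ∈ K := by simpa using hx
    exact Subtype.ext (Submodule.disjoint_def.1 hKE _ this x.2)) E.subtype
  replace hh : ∀ e ∈ E, h (K.mkQ e) = e := fun e he => hh ⟨e, he⟩
  have hEr : E ≤ LinearMap.range h := fun e he => ⟨_, hh e he⟩
  have hrE : LinearMap.range h ≤ E := by
    refine hmax.le_of_ge ⟨hE.1.trans hEr, ?_⟩ hEr
    intro N hN hNM
    have h1 : N ⊓ E = ⊥ := hE.2 _ inf_le_right (le_bot_iff.1 (by
      rw [← hNM]; exact inf_le_inf_right M inf_le_left))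
    have h2 := key (N.comap (h ∘ₗ K.mkQ)) (by
        intro x hx
        have : K.mkQ x = 0 := by simpa using hx
        simp only [Submodule.mem_comap, LinearMap.comp_apply, this, map_zero, zero_mem]) (by
        intro e he heN
        have h3 : e ∈ N := by
          have : h (K.mkQ e) ∈ N := heN
          rwa [hh e he] at this
        have h4 : e ∈ N ⊓ E := ⟨h3, he⟩
        rw [h1] at h4
        simpa using h4)
    rw [Submodule.eq_bot_iff]
    intro n hn
    obtain ⟨q, rfl⟩ := hN hn
    obtain ⟨q, rfl⟩ := K.mkQ_surjective q
    have : K.mkQ q = 0 := by simpa using h2 hn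
    rw [this, map_zero]
  refine ⟨E, hE.1, hE.2, ⟨fun X Y _ _ _ _ f hf g => ?_⟩⟩
  obtain ⟨k, hk⟩ := Module.Injective.out (R := Λ) (Q := Q) f hf (E.subtype ∘ₗ g)
  refine ⟨(h ∘ₗ K.mkQ ∘ₗ k).codRestrict E fun x => hrE ⟨_, rfl⟩, fun x => Subtype.ext ?_⟩
  have : k (f x) = g x := hk x
  simp only [LinearMap.codRestrict_apply, LinearMap.comp_apply, this]
  exact hh _ (g x).2

theorem exists_isInjectiveEnvelope (Λ : Type u) [Ring Λ] (M : Type u) [AddCommGroup M]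
    [Module Λ M] :
    ∃ (E : Type u) (_ : AddCommGroup E) (_ : Module Λ E) (f : M →ₗ[Λ] E),
      IsInjectiveEnvelope f := by
  let Q : ModuleCat.{u} Λ := CategoryTheory.Injective.under (ModuleCat.of Λ M)
  let i : M →ₗ[Λ] Q := (CategoryTheory.Injective.ι (ModuleCat.of Λ M)).hom
  have hi : Function.Injective i := (ModuleCat.mono_iff_injective _).1 inferInstance
  have hQ : CategoryTheory.Injective Q := CategoryTheory.Injective.injective_under _
  have : Module.Injective Λ Q := Module.injective_module_of_injective_object (R := Λ) (M := Q)
  obtain ⟨E, h1, h2, h3⟩ := exists_essential_injective_le (LinearMap.range i)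
  refine ⟨E, inferInstance, inferInstance, i.codRestrict E fun x => h1 ⟨x, rfl⟩, h3,
    fun x y h => hi (congrArg Subtype.val h), fun N hN => ?_⟩
  have h4 := h2 (N.map E.subtype) (Submodule.map_subtype_le E N) (by
    rw [Submodule.eq_bot_iff]
    rintro _ ⟨⟨n, hn, rfl⟩, m, hm⟩
    have : n ∈ N ⊓ LinearMap.range (i.codRestrict E fun x => h1 ⟨x, rfl⟩) :=
      ⟨hn, m, Subtype.ext hm⟩
    rw [hN] at this
    have : n = 0 := by simpa using this
    simp [this])
  exact Submodule.map_injective_of_injective E.subtype_injective (h4.trans (Submodule.map_bot _).symm)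

theorem isNoetherian_hom_of_essential (R : Type w) [CommRing R] [IsNoetherianRing R]
    {Λ : Type u} [Ring Λ] [Algebra R Λ] {E : Type u} [AddCommGroup E] [Module Λ E] [Module R E]
    [IsScalarTower R Λ E] (M : Submodule Λ E) [IsNoetherian R M]
    (hM : ∀ N : Submodule Λ E, N ⊓ M = ⊥ → N = ⊥)
    (X : Type u) [AddCommGroup X] [Module Λ X] (hX : IsFiniteLength Λ X) :
    IsNoetherian R (X →ₗ[Λ] E) := by
  induction hX with
  | of_subsingleton => infer_instance
  | @of_simple_quotient X _ _ N hs _ ih =>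
    let a : ((X ⧸ N) →ₗ[Λ] E) →ₗ[R] (X →ₗ[Λ] E) :=
      { toFun := fun f => f ∘ₗ N.mkQ, map_add' := fun _ _ => rfl, map_smul' := fun _ _ => rfl }
    let b : (X →ₗ[Λ] E) →ₗ[R] (N →ₗ[Λ] E) :=
      { toFun := fun f => f ∘ₗ N.subtype, map_add' := fun _ _ => rfl,
        map_smul' := fun _ _ => rfl }
    have := IsSimpleModule.nontrivial Λ (X ⧸ N)
    obtain ⟨s, hs0⟩ := exists_ne (0 : X ⧸ N)
    have hmem : ∀ f : (X ⧸ N) →ₗ[Λ] E, f s ∈ M := by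
      intro f
      rcases LinearMap.injective_or_eq_zero f with hf | hf
      · by_contra hfs
        have h1 : M.comap f = ⊥ := (eq_bot_or_eq_top (M.comap f)).resolve_right fun h => hfs (by
          have : s ∈ M.comap f := h ▸ Submodule.mem_top
          exact this)
        have h2 := hM (LinearMap.range f) (by
          rw [Submodule.eq_bot_iff]
          rintro _ ⟨⟨y, rfl⟩, hy⟩
          have : y ∈ M.comap f := hy
          rw [h1] at this
          have : y = 0 := by simpa using this
          rw [this, map_zero])
        apply hs0
        apply hf
        have : f s ∈ LinearMap.range f := ⟨s, rfl⟩
        rw [h2] at this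
        simpa using this
      · simp [hf]
    let ev : ((X ⧸ N) →ₗ[Λ] E) →ₗ[R] M :=
      { toFun := fun f => ⟨f s, hmem f⟩, map_add' := fun _ _ => rfl, map_smul' := fun _ _ => rfl }
    have hev : Function.Injective ev := by
      intro f g hfg
      have h1 : f s = g s := congrArg Subtype.val hfg
      have h2 : f - g = 0 := by
        rcases LinearMap.injective_or_eq_zero (f - g) with h | h
        · exact absurd (h (by simp [h1])) hs0
        · exact h
      exact sub_eq_zero.1 h2
    have : IsNoetherian R ((X ⧸ N) →ₗ[Λ] E) := isNoetherian_of_injective ev hev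
    refine isNoetherian_of_range_eq_ker a b ?_
    ext f
    constructor
    · rintro ⟨g, rfl⟩
      ext n
      have : N.mkQ (n : X) = 0 := by simp
      change g (N.mkQ (n : X)) = 0
      rw [this, map_zero]
    · intro hf
      refine ⟨N.liftQ f fun n hn => ?_, ?_⟩
      · exact LinearMap.congr_fun (show f ∘ₗ N.subtype = 0 from hf) ⟨n, hn⟩
      · ext x
        rfl

theorem IsInjectiveEnvelope.finite (R : Type w) [CommRing R] [IsArtinianRing R]
    {Λ : Type u} [Ring Λ] [Algebra R Λ] [Module.Finite R Λ] {M E : Type u} [AddCommGroup M]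
    [Module Λ M] [Module.Finite Λ M] [AddCommGroup E] [Module Λ E] {f : M →ₗ[Λ] E}
    (hf : IsInjectiveEnvelope f) : Module.Finite Λ E := by
  let _ : Module R E := Module.compHom E (algebraMap R Λ)
  have : IsScalarTower R Λ E := IsScalarTower.of_algebraMap_smul fun _ _ => rfl
  have : Module.Finite R (LinearMap.range f) := Module.Finite.trans Λ _
  have hn : IsNoetherian R Λ := inferInstance
  have : IsArtinian R Λ := inferInstance
  have : IsNoetherian Λ Λ := isNoetherian_of_tower R hn
  have : IsArtinian Λ Λ := isArtinian_of_tower R inferInstance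
  have h := isNoetherian_hom_of_essential R (LinearMap.range f) hf.essential Λ
    (isFiniteLength_iff_isNoetherian_isArtinian.2 ⟨inferInstance, inferInstance⟩)
  let ev : (Λ →ₗ[Λ] E) →ₗ[R] E :=
    { toFun := fun g => g 1, map_add' := fun _ _ => rfl, map_smul' := fun _ _ => rfl }
  have hev : Function.Surjective ev := fun e => ⟨LinearMap.toSpanSingleton Λ E e, by simp [ev]⟩
  have : Module.Finite R E := Module.Finite.of_surjective ev hev
  exact Module.Finite.of_restrictScalars_finite R Λ E

/-- `N` is a cosyzygy `Ω⁻¹(M)` of `M`: the cokernel of an injective envelope of `M`. -/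
def IsCosyzygy {Λ : Type u} [Ring Λ] (M N : FGModuleCat.{u} Λ) : Prop :=
  ∃ (E : FGModuleCat.{u} Λ) (f : M →ₗ[Λ] E),
    IsInjectiveEnvelope f ∧ Nonempty (N ≃ₗ[Λ] (E ⧸ LinearMap.range f))

theorem exists_isCosyzygy (R : Type w) [CommRing R] [IsArtinianRing R] {Λ : Type u} [Ring Λ]
    [Algebra R Λ] [Module.Finite R Λ] (M : FGModuleCat.{u} Λ) : ∃ N, IsCosyzygy M N := by
  obtain ⟨E, _, _, f, hf⟩ := exists_isInjectiveEnvelope Λ M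
  have : Module.Finite Λ E := hf.finite R
  exact ⟨FGModuleCat.of Λ (E ⧸ LinearMap.range f), FGModuleCat.of Λ E, f, hf,
    ⟨LinearEquiv.refl Λ _⟩⟩

/-- The cosyzygy `Ω⁻¹(M)` of a finitely generated module over an artin `R`-algebra `Λ`. -/
noncomputable def cosyzygy (R : Type w) [CommRing R] [IsArtinianRing R] {Λ : Type u} [Ring Λ]
    [Algebra R Λ] [Module.Finite R Λ] (M : FGModuleCat.{u} Λ) : FGModuleCat.{u} Λ :=
  (exists_isCosyzygy R M).choose

/-- The relations of the group `K₀` used for cosyzygies: `[C] = [A] + [B]` if `C ≃ A ⊕ B`, and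
`[I] = 0` if `I` is injective. -/
def injK0Relations (Λ : Type u) [Ring Λ] :
    AddSubgroup (FreeAbelianGroup (FGModuleCat.{u} Λ)) :=
  AddSubgroup.closure
    ({x | ∃ A B C : FGModuleCat.{u} Λ, Nonempty (C ≃ₗ[Λ] (A × B)) ∧
        x = FreeAbelianGroup.of C - (FreeAbelianGroup.of A + FreeAbelianGroup.of B)} ∪
      {x | ∃ I : FGModuleCat.{u} Λ, Module.Injective Λ I ∧ x = FreeAbelianGroup.of I})

/-- The abelian group generated by all symbols `[M]`, `M` a finitely generated `Λ`-module, modulo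
`[C] = [A] + [B]` if `C ≃ A ⊕ B`, and `[I] = 0` if `I` is injective. -/
abbrev InjK0 (Λ : Type u) [Ring Λ] : Type (u + 1) :=
  FreeAbelianGroup (FGModuleCat.{u} Λ) ⧸ injK0Relations Λ

/-- The class `[M]`. -/
def InjK0.mk {Λ : Type u} [Ring Λ] (M : FGModuleCat.{u} Λ) : InjK0 Λ :=
  QuotientAddGroup.mk (FreeAbelianGroup.of M)

theorem InjK0.mk_eq_add {Λ : Type u} [Ring Λ] {A B C : FGModuleCat.{u} Λ}
    (e : C ≃ₗ[Λ] (A × B)) : InjK0.mk C = InjK0.mk A + InjK0.mk B := by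
  rw [← sub_eq_zero]
  exact (QuotientAddGroup.eq_zero_iff _).2
    (AddSubgroup.subset_closure (Or.inl ⟨A, B, C, ⟨e⟩, rfl⟩))

theorem InjK0.mk_eq_zero {Λ : Type u} [Ring Λ] (I : FGModuleCat.{u} Λ)
    (hI : Module.Injective Λ I) : InjK0.mk I = 0 :=
  (QuotientAddGroup.eq_zero_iff _).2 (AddSubgroup.subset_closure (Or.inr ⟨I, hI, rfl⟩))

theorem injective_of_subsingleton (Λ : Type u) [Ring Λ] (Z : Type u) [AddCommGroup Z]
    [Module Λ Z] [Subsingleton Z] : Module.Injective Λ Z :=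
  ⟨fun _ _ _ _ _ _ _ _ _ => ⟨0, fun _ => Subsingleton.elim _ _⟩⟩

theorem InjK0.mk_congr {Λ : Type u} [Ring Λ] {A C : FGModuleCat.{u} Λ} (e : C ≃ₗ[Λ] A) :
    InjK0.mk C = InjK0.mk A := by
  have h := InjK0.mk_eq_zero (FGModuleCat.of Λ PUnit.{u + 1})
    (injective_of_subsingleton Λ PUnit.{u + 1})
  have e' : C ≃ₗ[Λ] (A × FGModuleCat.of Λ PUnit.{u + 1}) :=
    e.trans (LinearEquiv.prodUnique (R := Λ) (M := A) (M₂ := PUnit.{u + 1})).symm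
  rw [InjK0.mk_eq_add e', h, add_zero]

/-- Half of the dual of Schanuel's lemma. -/
theorem nonempty_quotient_prod_equiv {Λ : Type u} [Ring Λ] {M I J : Type u} [AddCommGroup M]
    [Module Λ M] [AddCommGroup I] [Module Λ I] [AddCommGroup J] [Module Λ J]
    (f : M →ₗ[Λ] I) (g : M →ₗ[Λ] J) (hf : Function.Injective f) (hJ : Module.Injective Λ J) :
    Nonempty (((I × J) ⧸ LinearMap.range (f.prod g)) ≃ₗ[Λ] ((I ⧸ LinearMap.range f) × J)) := by
  obtain ⟨h, hh⟩ := hJ.out f hf g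
  let q : (I × J) →ₗ[Λ] ((I ⧸ LinearMap.range f) × J) :=
    ((LinearMap.range f).mkQ ∘ₗ LinearMap.fst Λ I J).prod
      (LinearMap.snd Λ I J - h ∘ₗ LinearMap.fst Λ I J)
  have hq : Function.Surjective q := by
    rintro ⟨i, j⟩
    obtain ⟨i, rfl⟩ := (LinearMap.range f).mkQ_surjective i
    exact ⟨(i, j + h i), by simp [q]⟩
  have hk : LinearMap.range (f.prod g) = LinearMap.ker q := by
    ext ⟨i, j⟩
    constructor
    · rintro ⟨m, hm⟩
      obtain ⟨rfl, rfl⟩ : f m = i ∧ g m = j := ⟨congrArg Prod.fst hm, congrArg Prod.snd hm⟩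
      simp [q, hh]
    · intro hx
      have h1 : (LinearMap.range f).mkQ i = 0 := congrArg Prod.fst hx
      have h2 : j - h i = 0 := congrArg Prod.snd hx
      obtain ⟨m, rfl⟩ : i ∈ LinearMap.range f := by simpa using h1
      exact ⟨m, by simp [← hh, sub_eq_zero.1 h2]⟩
  exact ⟨(Submodule.quotEquivOfEq _ _ hk).trans (q.quotKerEquivOfSurjective hq)⟩

/-- The class of the cokernel of an embedding of `M` into a finitely generated injective module
does not depend on the embedding. -/
theorem InjK0.mk_quotient_eq {Λ : Type u} [Ring Λ] {M I J : FGModuleCat.{u} Λ}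
    (f : M →ₗ[Λ] I) (g : M →ₗ[Λ] J) (hf : Function.Injective f) (hg : Function.Injective g)
    (hI : Module.Injective Λ I) (hJ : Module.Injective Λ J) :
    InjK0.mk (FGModuleCat.of Λ (I ⧸ LinearMap.range f)) =
      InjK0.mk (FGModuleCat.of Λ (J ⧸ LinearMap.range g)) := by
  obtain ⟨e₁⟩ := nonempty_quotient_prod_equiv f g hf hJ
  obtain ⟨e₂⟩ := nonempty_quotient_prod_equiv g f hg hI
  have e₃ : ((I × J) ⧸ LinearMap.range (f.prod g)) ≃ₗ[Λ]
      ((J × I) ⧸ LinearMap.range (g.prod f)) :=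
    Submodule.Quotient.equiv _ _ (LinearEquiv.prodComm Λ I J) (by
      rw [← LinearMap.range_comp]; rfl)
  have h₁ := InjK0.mk_eq_add (A := FGModuleCat.of Λ (I ⧸ LinearMap.range f)) (B := J)
    (C := FGModuleCat.of Λ ((I × J) ⧸ LinearMap.range (f.prod g))) e₁
  have h₂ := InjK0.mk_eq_add (A := FGModuleCat.of Λ (J ⧸ LinearMap.range g)) (B := I)
    (C := FGModuleCat.of Λ ((J × I) ⧸ LinearMap.range (g.prod f))) e₂
  have h₃ := InjK0.mk_congr (C := FGModuleCat.of Λ ((I × J) ⧸ LinearMap.range (f.prod g)))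
    (A := FGModuleCat.of Λ ((J × I) ⧸ LinearMap.range (g.prod f))) e₃
  rw [InjK0.mk_eq_zero J hJ, add_zero] at h₁
  rw [InjK0.mk_eq_zero I hI, add_zero] at h₂
  rw [← h₁, h₃, h₂]

/-- `X` is an indecomposable direct summand of `M`. -/
def IsIndecomposableSummand {Λ : Type u} [Ring Λ] (X M : FGModuleCat.{u} Λ) : Prop :=
  Nontrivial X ∧
    (∀ A B : FGModuleCat.{u} Λ, Nonempty (X ≃ₗ[Λ] (A × B)) → Subsingleton A ∨ Subsingleton B) ∧
    ∃ Y : FGModuleCat.{u} Λ, Nonempty (M ≃ₗ[Λ] (X × Y))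

/-- The subgroup `⟨add M⟩` of `K₀` generated by the indecomposable summands of `M`. -/
def addSpan {Λ : Type u} [Ring Λ] (M : FGModuleCat.{u} Λ) : AddSubgroup (InjK0 Λ) :=
  AddSubgroup.closure {x | ∃ X : FGModuleCat.{u} Λ, IsIndecomposableSummand X M ∧ x = InjK0.mk X}

section

variable (R : Type w) [CommRing R] [IsArtinianRing R] {Λ : Type u} [Ring Λ] [Algebra R Λ]
  [Module.Finite R Λ]

theorem InjK0.mk_cosyzygy_eq {M J : FGModuleCat.{u} Λ} (g : M →ₗ[Λ] J)
    (hg : Function.Injective g) (hJ : Module.Injective Λ J) :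
    InjK0.mk (cosyzygy R M) = InjK0.mk (FGModuleCat.of Λ (J ⧸ LinearMap.range g)) := by
  obtain ⟨E, f, hf, ⟨e⟩⟩ := (exists_isCosyzygy R M).choose_spec
  have h := InjK0.mk_congr (C := cosyzygy R M)
    (A := FGModuleCat.of Λ (E ⧸ LinearMap.range f)) e
  rw [h, InjK0.mk_quotient_eq f g hf.injective hg hf.injective_module hJ]

theorem InjK0.mk_cosyzygy_add {A B C : FGModuleCat.{u} Λ} (e : C ≃ₗ[Λ] (A × B)) :
    InjK0.mk (cosyzygy R C) = InjK0.mk (cosyzygy R A) + InjK0.mk (cosyzygy R B) := by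
  obtain ⟨E, f, hf, -⟩ := (exists_isCosyzygy R A).choose_spec
  obtain ⟨F, g, hg, -⟩ := (exists_isCosyzygy R B).choose_spec
  have hEF : Module.Injective Λ (E × F) := by
    refine ⟨fun X Y _ _ _ _ i hi k => ?_⟩
    obtain ⟨a, ha⟩ := hf.injective_module.out i hi (LinearMap.fst Λ E F ∘ₗ k)
    obtain ⟨b, hb⟩ := hg.injective_module.out i hi (LinearMap.snd Λ E F ∘ₗ k)
    exact ⟨a.prod b, fun x => Prod.ext (ha x) (hb x)⟩
  have hfg : Function.Injective (f.prodMap g) := hf.injective.prodMap hg.injective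
  let k : (E × F) →ₗ[Λ] ((E ⧸ LinearMap.range f) × (F ⧸ LinearMap.range g)) :=
    (LinearMap.range f).mkQ.prodMap (LinearMap.range g).mkQ
  have hk : Function.Surjective k :=
    (LinearMap.range f).mkQ_surjective.prodMap (LinearMap.range g).mkQ_surjective
  have hker : LinearMap.range (f.prodMap g ∘ₗ e.toLinearMap) = LinearMap.ker k := by
    rw [LinearMap.range_comp, LinearEquiv.range, Submodule.map_top]
    ext ⟨x, y⟩
    simp [k, LinearMap.range_prodMap]
  have e' := (Submodule.quotEquivOfEq _ _ hker).trans (k.quotKerEquivOfSurjective hk)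
  rw [InjK0.mk_cosyzygy_eq R (J := FGModuleCat.of Λ (E × F)) (f.prodMap g ∘ₗ e.toLinearMap)
      (hfg.comp e.injective) hEF,
    InjK0.mk_cosyzygy_eq R f hf.injective hf.injective_module,
    InjK0.mk_cosyzygy_eq R g hg.injective hg.injective_module]
  exact InjK0.mk_eq_add (A := FGModuleCat.of Λ (E ⧸ LinearMap.range f))
    (B := FGModuleCat.of Λ (F ⧸ LinearMap.range g))
    (C := FGModuleCat.of Λ ((E × F) ⧸ LinearMap.range (f.prodMap g ∘ₗ e.toLinearMap))) e'

theorem InjK0.mk_cosyzygy_injective {I : FGModuleCat.{u} Λ} (hI : Module.Injective Λ I) :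
    InjK0.mk (cosyzygy R I) = 0 := by
  rw [InjK0.mk_cosyzygy_eq R (J := I) LinearMap.id Function.injective_id hI]
  have : Subsingleton (I ⧸ LinearMap.range (LinearMap.id : I →ₗ[Λ] I)) := by
    rw [LinearMap.range_id]
    infer_instance
  exact InjK0.mk_eq_zero _ (injective_of_subsingleton Λ (I ⧸ LinearMap.range LinearMap.id))

variable (Λ) in
/-- The endomorphism of `K₀` induced by the cosyzygy, `[M] ↦ [Ω⁻¹(M)]`. -/
noncomputable def cosyzygyHom : InjK0 Λ →+ InjK0 Λ :=
  QuotientAddGroup.lift (injK0Relations Λ)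
    (FreeAbelianGroup.lift fun M : FGModuleCat.{u} Λ => InjK0.mk (cosyzygy R M)) (by
      refine (AddSubgroup.closure_le _).2 ?_
      rintro x (⟨A, B, C, ⟨e⟩, rfl⟩ | ⟨I, hI, rfl⟩)
      · simp [InjK0.mk_cosyzygy_add R e]
      · simp [InjK0.mk_cosyzygy_injective R hI])

theorem cosyzygyHom_mk (M : FGModuleCat.{u} Λ) :
    cosyzygyHom R Λ (InjK0.mk M) = InjK0.mk (cosyzygy R M) := by
  simp [cosyzygyHom, InjK0.mk]

/-- The subgroup `Ω⁻ˢ⟨add M⟩` of `K₀`. -/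
noncomputable def cosyzygyAddSpan (M : FGModuleCat.{u} Λ) (s : ℕ) : AddSubgroup (InjK0 Λ) :=
  (AddSubgroup.map (cosyzygyHom R Λ))^[s] (addSpan M)

/-- The Igusa-Todorov function `φ_r`: the least `n` such that `Ω⁻¹` restricts to an isomorphism
`Ω⁻ˢ⟨add M⟩ → Ω⁻ˢ⁻¹⟨add M⟩` for all `s ≥ n` (`⊤` if there were no such `n`). -/
noncomputable def phiR (M : FGModuleCat.{u} Λ) : ℕ∞ :=
  ⨅ n ∈ {n : ℕ | ∀ s ≥ n, Set.BijOn (cosyzygyHom R Λ)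
    (cosyzygyAddSpan R M s) (cosyzygyAddSpan R M (s + 1))}, (n : ℕ∞)

variable (Λ) in
/-- `φ_r dim(Λ)`, the supremum of `φ_r(M)` over all finitely generated `Λ`-modules `M`. -/
noncomputable def phiRDim : ℕ∞ :=
  ⨆ M : FGModuleCat.{u} Λ, phiR R M

end

/-- The projective dimension of a `Λ`-module, with the convention `pd 0 = 0`. -/
noncomputable def projDim {Λ : Type u} [Ring Λ] (M : ModuleCat.{u} Λ) : ℕ∞ :=
  (CategoryTheory.projectiveDimension M).unbotD 0

/-- The global dimension of an artin algebra: the supremum of the projective dimensions of its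
finitely generated left modules. -/
noncomputable def gldim (Γ : Type u) [Ring Γ] : ℕ∞ :=
  ⨆ M : FGModuleCat.{u} Γ, projDim M.obj

/-- The trace of `P` in `Λ`: the left ideal generated by the images of all maps `P → Λ`. -/
def traceIdeal (Λ : Type u) [Ring Λ] (P : Type u) [AddCommGroup P] [Module Λ P] : Ideal Λ :=
  ⨆ f : P →ₗ[Λ] Λ, LinearMap.range f

theorem restrictScalars_map_exact_of_ring {A B : Type u} [Ring A] [Ring B] (f : A →+* B)
    (S : CategoryTheory.ShortComplex (ModuleCat.{u} B)) (h : S.Exact) :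
    (S.map (ModuleCat.restrictScalars.{u} f)).Exact := by
  rw [CategoryTheory.ShortComplex.ShortExact.moduleCat_exact_iff_function_exact] at h ⊢
  exact h

instance restrictScalars_preservesFiniteLimits_of_ring {A B : Type u} [Ring A] [Ring B]
    (f : A →+* B) :
    CategoryTheory.Limits.PreservesFiniteLimits (ModuleCat.restrictScalars.{u} f) := by
  have h := ((CategoryTheory.Functor.exact_tfae (ModuleCat.restrictScalars.{u} f)).out 1 3).mp
    (restrictScalars_map_exact_of_ring f)
  exact h.1

instance restrictScalars_preservesFiniteColimits_of_ring {A B : Type u} [Ring A] [Ring B]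
    (f : A →+* B) :
    CategoryTheory.Limits.PreservesFiniteColimits (ModuleCat.restrictScalars.{u} f) := by
  have h := ((CategoryTheory.Functor.exact_tfae (ModuleCat.restrictScalars.{u} f)).out 1 3).mp
    (restrictScalars_map_exact_of_ring f)
  exact h.2

/-- A two-sided ideal `𝔄` is a strong idempotent ideal if it is idempotent and, for all finitely
generated `Λ/𝔄`-modules `X`, `Y` and all `i ≥ 0`, the canonical map
`Extⁱ_{Λ/𝔄}(X, Y) → Extⁱ_Λ(X, Y)` given by restriction of scalars is an isomorphism. -/
def IsStrongIdempotentIdeal {Λ : Type u} [Ring Λ] (𝔄 : Ideal Λ) [𝔄.IsTwoSided] : Prop :=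
  𝔄 * 𝔄 = 𝔄 ∧
    ∀ (X Y : FGModuleCat.{u} (Λ ⧸ 𝔄)) (i : ℕ),
      Function.Bijective
        ((ModuleCat.restrictScalars.{u} (Ideal.Quotient.mk 𝔄)).mapExtAddHom X.obj Y.obj i)

/-- `Λ/𝔄` as a left `Λ`-module. -/
abbrev leftQuotient {Λ : Type u} [Ring Λ] (𝔄 : Ideal Λ) : ModuleCat.{u} Λ :=
  ModuleCat.of Λ (Λ ⧸ 𝔄)

/-- `Λ/𝔄` as a right `Λ`-module, that is, as a left module over the opposite ring. -/
noncomputable abbrev rightQuotient {Λ : Type u} [Ring Λ] (𝔄 : Ideal Λ) [𝔄.IsTwoSided] : ModuleCat.{u} Λᵐᵒᵖ :=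
  (ModuleCat.restrictScalars.{u} (Ideal.Quotient.mk 𝔄).op).obj (ModuleCat.of (Λ ⧸ 𝔄)ᵐᵒᵖ (Λ ⧸ 𝔄))

/-! Let d and e be the projective dimensions of Λ/𝔄 on the left and on the right, g = gld Γ, p = φ_r
dim(Λ/𝔄); all may be assumed finite. Since Ω⁻¹ maps Ω⁻ˢ⟨add M⟩ onto Ω⁻ˢ⁻¹⟨add M⟩ by definition, only
injectivity matters: φ_r dim ≤ n means that Ω⁻⁽ˢ⁺¹⁾x = 0 implies Ω⁻ˢx = 0 for all s ≥ n and all x in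
K₀.

Kernels are compared through two homomorphisms: F : K₀(Λ) → K₀(Λ/𝔄), [M] ↦ [M^𝔄], where M^𝔄 ≅
Hom(Λ/𝔄, M) is the part killed by 𝔄, and G : K₀(Λ/𝔄) → K₀(Λ), [X] ↦ Ω⁻ᵉ[X]. G is well defined and
commutes with Ω⁻¹ because injective Λ/𝔄-modules have injective dimension at most e over Λ
(`injDimLT_of_injective_quotient`, by duality). F commutes with Ω⁻¹ on modules N with Extⁱ(Λ/𝔄, N) =
0 for i ≥ 1, and Ω⁻ᵈ moves every class to the class of such an N.

For such N let Q = N/N^𝔄. Strong idempotency gives Extⁱ(Λ/𝔄, N^𝔄) = 0 for i ≥ 1, hence Extⁱ(Λ/𝔄, Q)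
= 0 for all i ≥ 0. On modules like Q the functor Hom(P, -) to Γ-modules reflects injective dimension
(`injDimLT_of_extVanishes_hom`), so Q has injective dimension at most g, and N and N^𝔄 have equal
classes after g + 1 cosyzygies. Thus Ω⁻ᵗ[N] = Ω⁻⁽ᵗ⁻ᵉ⁾GF[N] for t ≥ max(g + 1, e)
(`iterate_cosyzygyHom_eq_resCosyzygyHom`).

If Ω⁻⁽ᵗ⁺ᵈ⁺¹⁾x = 0 with t ≥ max(g + 1, e + p), then y = F(Ω⁻ᵈx) is killed by Ω⁻⁽ᵗ⁺¹⁾, hence already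
by Ω⁻ᵖ; therefore Ω⁻⁽ᵗ⁺ᵈ⁾x = Ω⁻⁽ᵗ⁻ᵉ⁾Gy = Ω⁻⁽ᵗ⁻ᵉ⁻ᵖ⁾G(Ω⁻ᵖy) = 0. -/

section

/-! ### Short exact sequences, vanishing of Ext, and injective dimension. -/

open CategoryTheory CategoryTheory.Abelian

/-- The vanishing of `Extⁿ_Λ(X, Y)`. -/
abbrev ExtVanishes (Λ : Type u) [Ring Λ] (X Y : Type u) [AddCommGroup X] [Module Λ X]
    [AddCommGroup Y] [Module Λ Y] (n : ℕ) : Prop :=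
  Subsingleton (Ext (ModuleCat.of Λ X) (ModuleCat.of Λ Y) n)

/-- `Y` has injective dimension less than `n`. -/
abbrev InjDimLT (Λ : Type u) [Ring Λ] (Y : Type u) [AddCommGroup Y] [Module Λ Y] (n : ℕ) : Prop :=
  HasInjectiveDimensionLT (ModuleCat.of Λ Y) n

/-- `0 → A → B → C → 0` is exact. -/
structure IsShortExact {Λ : Type u} [Ring Λ] {A B C : Type u} [AddCommGroup A] [Module Λ A]
    [AddCommGroup B] [Module Λ B] [AddCommGroup C] [Module Λ C] (f : A →ₗ[Λ] B) (g : B →ₗ[Λ] C) :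
    Prop where
  injective : Function.Injective f
  exact : Function.Exact f g
  surjective : Function.Surjective g

end

section

open CategoryTheory CategoryTheory.Abelian

variable {Λ : Type u} [Ring Λ] {A B C : Type u} [AddCommGroup A] [Module Λ A]
  [AddCommGroup B] [Module Λ B] [AddCommGroup C] [Module Λ C] {f : A →ₗ[Λ] B} {g : B →ₗ[Λ] C}

theorem isShortExact_mkQ_range (hf : Function.Injective f) :
    IsShortExact f (LinearMap.range f).mkQ where
  injective := hf
  exact x := by simp
  surjective := (LinearMap.range f).mkQ_surjective

theorem isShortExact_subtype_mkQ (N : Submodule Λ A) : IsShortExact N.subtype N.mkQ where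
  injective := N.subtype_injective
  exact x := by simp
  surjective := N.mkQ_surjective

/-- A short exact sequence as a short complex of modules. -/
abbrev IsShortExact.shortComplex (h : IsShortExact f g) :
    ShortComplex (ModuleCat.{u} Λ) :=
  ModuleCat.shortComplexOfCompEqZero f g h.exact.linearMap_comp_eq_zero

theorem IsShortExact.shortExact (h : IsShortExact f g) : h.shortComplex.ShortExact :=
  ModuleCat.shortComplex_shortExact _ h.exact h.injective h.surjective

theorem IsShortExact.extVanishes_right (h : IsShortExact f g) {X : Type u} [AddCommGroup X]
    [Module Λ X] {n : ℕ} (hB : ExtVanishes Λ X B n) (hA : ExtVanishes Λ X A (n + 1)) :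
    ExtVanishes Λ X C n := by
  refine subsingleton_of_forall_eq 0 fun x => ?_
  obtain ⟨y, rfl⟩ := Ext.covariant_sequence_exact₃ _ h.shortExact x rfl
    (hA.elim _ _)
  rw [hB.elim y 0, Ext.zero_comp]

theorem IsShortExact.injDimLT_right (h : IsShortExact f g) (hB : Module.Injective Λ B) {n : ℕ}
    (hA : InjDimLT Λ A (n + 2)) : InjDimLT Λ C (n + 1) :=
  (h.shortExact.hasInjectiveDimensionLT_X₃_iff n
    ((Module.injective_iff_injective_object Λ B).1 hB)).2 hA

theorem IsShortExact.injDimLT_left (h : IsShortExact f g) (hB : Module.Injective Λ B) {n : ℕ}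
    (hC : InjDimLT Λ C (n + 1)) : InjDimLT Λ A (n + 2) :=
  (h.shortExact.hasInjectiveDimensionLT_X₃_iff n
    ((Module.injective_iff_injective_object Λ B).1 hB)).1 hC

end

section

open CategoryTheory CategoryTheory.Abelian

variable {Λ : Type u} [Ring Λ]

theorem injDimLT_one_iff {Y : Type u} [AddCommGroup Y] [Module Λ Y] :
    InjDimLT Λ Y 1 ↔ Module.Injective Λ Y := by
  rw [Module.injective_iff_injective_object]
  exact injective_iff_hasInjectiveDimensionLT_one.symm

theorem extVanishes_of_injective {X Y : Type u} [AddCommGroup X] [Module Λ X] [AddCommGroup Y]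
    [Module Λ Y] (hY : Module.Injective Λ Y) (n : ℕ) : ExtVanishes Λ X Y (n + 1) :=
  have : Injective (ModuleCat.of Λ Y) :=
    (Module.injective_iff_injective_object Λ Y).1 hY
  HasInjectiveDimensionLT.subsingleton (ModuleCat.of Λ Y) 1 (n + 1)
    (by simp) _

theorem extVanishes_of_projective {X Y : Type u} [AddCommGroup X] [Module Λ X] [AddCommGroup Y]
    [Module Λ Y] (hX : Module.Projective Λ X) (n : ℕ) : ExtVanishes Λ X Y (n + 1) :=
  have : Projective (ModuleCat.of Λ X) :=
    (IsProjective.iff_projective X).1 hX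
  HasProjectiveDimensionLT.subsingleton (ModuleCat.of Λ X) 1 (n + 1)
    (by simp) _

theorem extVanishes_zero_iff {X Y : Type u} [AddCommGroup X] [Module Λ X] [AddCommGroup Y]
    [Module Λ Y] : ExtVanishes Λ X Y 0 ↔ Subsingleton (X →ₗ[Λ] Y) :=
  (Ext.homEquiv₀.trans ModuleCat.homEquiv).subsingleton_congr

theorem extVanishes_quotient_zero_iff (I : Ideal Λ) {Y : Type u} [AddCommGroup Y] [Module Λ Y] :
    ExtVanishes Λ (Λ ⧸ I) Y 0 ↔ ∀ y : Y, (∀ a ∈ I, a • y = 0) → y = 0 := by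
  rw [extVanishes_zero_iff]
  constructor
  · intro h y hy
    have := h.elim (I.liftQ (LinearMap.toSpanSingleton Λ Y y) fun a ha => hy a ha) 0
    simpa [-Ideal.Quotient.mk_eq_mk] using
      (Submodule.liftQ_apply I (LinearMap.toSpanSingleton Λ Y y) 1).symm.trans
        (LinearMap.congr_fun this (Submodule.Quotient.mk 1))
  · refine fun h => subsingleton_of_forall_eq 0 fun φ => ?_
    refine Submodule.linearMap_qext _ (LinearMap.ext_ring (h _ fun a ha => ?_))
    rw [← map_smul]
    have : I.mkQ a = 0 := by simpa using ha
    simp [this]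

/-- The obstruction to extending `θ` from `I` to Λ lies in Ext¹(Λ/I, Y); an extension to Λ is
determined by its value `y` at 1. -/
theorem exists_smul_eq_of_extVanishes (I : Ideal Λ) {Y : Type u} [AddCommGroup Y] [Module Λ Y]
    (h : ExtVanishes Λ (Λ ⧸ I) Y 1) (θ : I →ₗ[Λ] Y) : ∃ y : Y, ∀ a : I, θ a = (a : Λ) • y := by
  obtain ⟨x, hx⟩ := Ext.contravariant_sequence_exact₁
    (isShortExact_subtype_mkQ I).shortExact (ModuleCat.of Λ Y)
    (Ext.mk₀ (ModuleCat.ofHom θ)) (n₁ := 1) rfl (h.elim _ _)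
  obtain ⟨x, rfl⟩ := Ext.homEquiv₀.symm.surjective x
  replace hx : Ext.mk₀ (ModuleCat.ofHom I.subtype ≫ x) =
      Ext.mk₀ (ModuleCat.ofHom θ) := by
    rw [← Ext.mk₀_comp_mk₀]
    exact hx
  replace hx := Ext.homEquiv₀.symm.injective hx
  refine ⟨x.hom (1 : Λ), fun a => ?_⟩
  have := congrArg (fun z => z.hom a) hx
  rw [← map_smul]
  simpa using this.symm

theorem injective_of_extVanishes_one {Y : Type u} [AddCommGroup Y] [Module Λ Y]
    (h : ∀ I : Ideal Λ, ExtVanishes Λ (Λ ⧸ I) Y 1) : Module.Injective Λ Y := by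
  refine Module.Baer.injective fun I θ => ?_
  obtain ⟨y, hy⟩ := exists_smul_eq_of_extVanishes I (h I) θ
  exact ⟨LinearMap.toSpanSingleton Λ Y y, fun x hx => (hy ⟨x, hx⟩).symm⟩

theorem InjDimLT.of_retract {X Y : Type u} [AddCommGroup X] [Module Λ X] [AddCommGroup Y]
    [Module Λ Y] {n : ℕ} (h : InjDimLT Λ Y n) (i : X →ₗ[Λ] Y) (r : Y →ₗ[Λ] X)
    (hri : ∀ x, r (i x) = x) : InjDimLT Λ X n :=
  Retract.hasInjectiveDimensionLT
    { i := ModuleCat.ofHom i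
      r := ModuleCat.ofHom r
      retract := by ext x; exact hri x } n

theorem injective_of_retract {X Y : Type u} [AddCommGroup X] [Module Λ X] [AddCommGroup Y]
    [Module Λ Y] (h : Module.Injective Λ Y) (i : X →ₗ[Λ] Y) (r : Y →ₗ[Λ] X)
    (hri : ∀ x, r (i x) = x) : Module.Injective Λ X :=
  injDimLT_one_iff.1 ((injDimLT_one_iff.2 h).of_retract i r hri)

theorem hasProjectiveDimensionLT_of_projDim_le {M : ModuleCat.{u} Λ} {n : ℕ}
    (h : projDim M ≤ n) : HasProjectiveDimensionLT M (n + 1) := by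
  refine (projectiveDimension_le_iff M n).1 ?_
  unfold projDim at h
  induction hx : projectiveDimension M using WithBot.recBotCoe with
  | bot => exact bot_le
  | coe a =>
    rw [hx] at h
    exact_mod_cast h

theorem extVanishes_of_hasProjectiveDimensionLT {X Y : Type u} [AddCommGroup X] [Module Λ X]
    [AddCommGroup Y] [Module Λ Y] {n : ℕ}
    (h : HasProjectiveDimensionLT (ModuleCat.of Λ X) n) {i : ℕ} (hi : n ≤ i) :
    ExtVanishes Λ X Y i :=
  HasProjectiveDimensionLT.subsingleton _ n i hi _

end

/-- The submodule of elements of `N` annihilated by the two-sided ideal `𝔄`. -/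
def annihilatedBy {Λ : Type u} [Ring Λ] (𝔄 : Ideal Λ) [𝔄.IsTwoSided] (N : Type u) [AddCommGroup N]
    [Module Λ N] : Submodule Λ N where
  carrier := {x | ∀ a ∈ 𝔄, a • x = 0}
  add_mem' hx hy a ha := by rw [smul_add, hx a ha, hy a ha, add_zero]
  zero_mem' a _ := smul_zero a
  smul_mem' r x hx a ha := by
    rw [smul_smul]
    exact hx _ (Ideal.mul_mem_right _ _ ha)

/-! ### The functor Hom(P, -) and modules without Ext from Λ/𝔄. -/

section

variable {Λ : Type u} [Ring Λ] {P : Type u} [AddCommGroup P] [Module Λ P]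

/-- `Hom_Λ(P, M)` as a left module over `End_Λ(P)ᵒᵖ`, acting by precomposition. -/
abbrev homModule (M : Type u) [AddCommGroup M] [Module Λ M] :
    Module (Module.End Λ P)ᵐᵒᵖ (P →ₗ[Λ] M) where
  smul γ f := f ∘ₗ γ.unop
  one_smul _ := rfl
  mul_smul _ _ _ := rfl
  smul_zero _ := LinearMap.zero_comp _
  smul_add _ _ _ := LinearMap.add_comp _ _ _
  add_smul _ _ _ := LinearMap.comp_add _ _ _
  zero_smul _ := LinearMap.comp_zero _

attribute [local instance] homModule

theorem homModule_smul_apply {M : Type u} [AddCommGroup M] [Module Λ M]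
    (γ : (Module.End Λ P)ᵐᵒᵖ) (f : P →ₗ[Λ] M) (p : P) : (γ • f) p = f (γ.unop p) := rfl

/-- Postcomposition `Hom_Λ(P, M) → Hom_Λ(P, N)` as a map of `End_Λ(P)ᵒᵖ`-modules. -/
def homMap (P : Type u) [AddCommGroup P] [Module Λ P] {M N : Type u} [AddCommGroup M] [Module Λ M]
    [AddCommGroup N] [Module Λ N] (ψ : M →ₗ[Λ] N) :
    (P →ₗ[Λ] M) →ₗ[(Module.End Λ P)ᵐᵒᵖ] (P →ₗ[Λ] N) where
  toFun f := ψ ∘ₗ f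
  map_add' _ _ := LinearMap.comp_add _ _ _
  map_smul' _ _ := rfl

theorem IsShortExact.homMap [Module.Projective Λ P] {A B C : Type u} [AddCommGroup A] [Module Λ A]
    [AddCommGroup B] [Module Λ B] [AddCommGroup C] [Module Λ C] {f : A →ₗ[Λ] B} {g : B →ₗ[Λ] C}
    (h : IsShortExact f g) : IsShortExact (homMap P f) (homMap P g) where
  injective a b hab := LinearMap.ext fun p => h.injective (LinearMap.congr_fun hab p)
  exact φ := by
    constructor
    · intro hφ
      have hr : ∀ p, φ p ∈ LinearMap.range f := fun p => (h.exact _).1 (LinearMap.congr_fun hφ p)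
      refine ⟨(LinearEquiv.ofInjective f h.injective).symm.toLinearMap ∘ₗ φ.codRestrict _ hr,
        LinearMap.ext fun p => ?_⟩
      exact congrArg Subtype.val
        ((LinearEquiv.ofInjective f h.injective).apply_symm_apply ⟨φ p, hr p⟩)
    · rintro ⟨a, rfl⟩
      exact LinearMap.ext fun p => h.exact.apply_apply_eq_zero (a p)
  surjective φ := Module.projective_lifting_property g φ h.surjective

/-- The annihilator of `c` is a left ideal, so it contains the trace as soon as it contains each
value `g q`. -/
theorem smul_eq_zero_of_mem_traceIdeal {C : Type u} [AddCommGroup C] [Module Λ C] {c : C}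
    (hc : ∀ (g : P →ₗ[Λ] Λ) (q : P), g q • c = 0) {a : Λ} (ha : a ∈ traceIdeal Λ P) :
    a • c = 0 := by
  have h : traceIdeal Λ P ≤ LinearMap.ker (LinearMap.toSpanSingleton Λ C c) := by
    refine iSup_le fun g => ?_
    rintro _ ⟨q, rfl⟩
    exact hc g q
  exact h ha

/-- A map between modules of homomorphisms out of `P` is, on the submodule of `M` spanned by the
images of the homomorphisms it is defined on, induced by a map of `Λ`-modules. -/
theorem exists_linearMap_of_hom {M C : Type u} [AddCommGroup M] [Module Λ M] [AddCommGroup C]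
    [Module Λ C] (hC : ∀ c : C, (∀ a ∈ traceIdeal Λ P, a • c = 0) → c = 0)
    {S : Type u} [AddCommGroup S] [Module (Module.End Λ P)ᵐᵒᵖ S]
    (ι : S →ₗ[(Module.End Λ P)ᵐᵒᵖ] (P →ₗ[Λ] M)) (hι : Function.Injective ι)
    (φ : S →ₗ[(Module.End Λ P)ᵐᵒᵖ] (P →ₗ[Λ] C)) :
    ∃ (N : Submodule Λ M) (θ : N →ₗ[Λ] C),
      ∀ s p, ∃ h : ι s p ∈ N, θ ⟨ι s p, h⟩ = φ s p := by
  -- Formal sums of pairs (s, p) are evaluated through `ι` and through `φ`; the desired map sends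
  -- the first value to the second, so it exists once the kernels are nested.
  let ev : (S →₀ P) →ₗ[Λ] M := Finsupp.lsum ℕ fun s => ι s
  let ev' : (S →₀ P) →ₗ[Λ] C := Finsupp.lsum ℕ fun s => φ s
  have hker : LinearMap.ker ev ≤ LinearMap.ker ev' := by
    intro z hz
    refine hC _ fun a ha => smul_eq_zero_of_mem_traceIdeal (fun g q => ?_) ha
    -- Precomposing `s` with x ↦ g x • p turns the coefficient `g x` into an element of Γ. Then ι T
    -- is x ↦ g x • ev z = 0, so T = 0, while φ T takes the value g q • ev' z at q.
    let T : S := z.sum fun s p => (MulOpposite.op (g.smulRight p) : (Module.End Λ P)ᵐᵒᵖ) • s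
    have hT : T = 0 := by
      apply hι
      ext x
      have h1 : ι T x = g x • ev z := by
        simp [T, ev, Finsupp.sum, homModule_smul_apply, Finset.smul_sum]
      rw [h1, show ev z = 0 from hz]
      simp
    have h2 : g q • ev' z = φ T q := by
      simp [T, ev', Finsupp.sum, homModule_smul_apply, Finset.smul_sum]
    rw [h2, hT]
    simp
  refine ⟨LinearMap.range ev,
    (LinearMap.ker ev).liftQ ev' hker ∘ₗ ev.quotKerEquivRange.symm.toLinearMap, fun s p => ?_⟩
  have h1 : ev (Finsupp.single s p) = ι s p := by simp [ev]
  have h2 : ev' (Finsupp.single s p) = φ s p := by simp [ev']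
  rw [← h1, ← h2]
  refine ⟨⟨_, rfl⟩, ?_⟩
  have h3 : ev.quotKerEquivRange.symm ⟨ev (Finsupp.single s p), ⟨_, rfl⟩⟩ =
      (LinearMap.ker ev).mkQ (Finsupp.single s p) := by
    rw [LinearEquiv.symm_apply_eq]
    rfl
  rw [LinearMap.comp_apply, LinearEquiv.coe_coe, h3]
  rfl

/-- Baer's criterion: a left ideal of Γ sits inside Hom(P, P), so a map from it to Hom(P, E) is
induced by a map from a submodule of P to E. Extending that map to P gives the required element of
Hom(P, E). -/
theorem injective_hom_of_injective {E : Type u} [AddCommGroup E] [Module Λ E]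
    (hE : Module.Injective Λ E) (hC : ∀ c : E, (∀ a ∈ traceIdeal Λ P, a • c = 0) → c = 0) :
    Module.Injective (Module.End Λ P)ᵐᵒᵖ (P →ₗ[Λ] E) := by
  refine Module.Baer.injective fun I φ => ?_
  let ι : I →ₗ[(Module.End Λ P)ᵐᵒᵖ] (P →ₗ[Λ] P) :=
    { toFun := fun x => x.1.unop, map_add' := fun _ _ => rfl, map_smul' := fun _ _ => rfl }
  have hι : Function.Injective ι := fun x y h => Subtype.ext (MulOpposite.unop_injective h)
  obtain ⟨N, θ, hθ⟩ := exists_linearMap_of_hom hC ι hι φ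
  obtain ⟨θ', hθ'⟩ := hE.out N.subtype N.subtype_injective θ
  refine ⟨LinearMap.toSpanSingleton _ _ θ', fun x hx => LinearMap.ext fun p => ?_⟩
  obtain ⟨h, h'⟩ := hθ ⟨x, hx⟩ p
  rw [← h', ← hθ' ⟨_, h⟩]
  rfl

/-- Maps `Hom_Λ(P, M) → Hom_Λ(P, C)` are induced by maps `M → C` when `C → Hom_Λ(𝔄, C)` is
bijective for the trace ideal `𝔄` of `P`. -/
theorem exists_homMap_eq [(traceIdeal Λ P).IsTwoSided] {M C : Type u} [AddCommGroup M]
    [Module Λ M] [AddCommGroup C] [Module Λ C] (hC : ∀ c : C, (∀ a ∈ traceIdeal Λ P, a • c = 0) → c = 0)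
    (hC' : ∀ θ : traceIdeal Λ P →ₗ[Λ] C, ∃ c : C, ∀ a, θ a = (a : Λ) • c)
    (φ : (P →ₗ[Λ] M) →ₗ[(Module.End Λ P)ᵐᵒᵖ] (P →ₗ[Λ] C)) :
    ∃ ψ : M →ₗ[Λ] C, homMap P ψ = φ := by
  obtain ⟨N, θ, hθ⟩ := exists_linearMap_of_hom hC LinearMap.id Function.injective_id φ
  -- N is only known to contain the values of the maps P → M; since p ↦ g p • m is such a map, it
  -- contains 𝔄M.
  have hN : ∀ m : M, ∀ a ∈ traceIdeal Λ P, a • m ∈ N := by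
    intro m
    have h : traceIdeal Λ P ≤ N.comap (LinearMap.toSpanSingleton Λ M m) := by
      refine iSup_le fun g => ?_
      rintro _ ⟨q, rfl⟩
      exact (hθ (g.smulRight m) q).1
    exact fun a ha => h ha
  have h1 : ∀ m : M, ∃ c : C, ∀ a (ha : a ∈ traceIdeal Λ P), θ ⟨a • m, hN m a ha⟩ = a • c := by
    intro m
    -- The map a ↦ θ(a • m) on 𝔄 is multiplication by a unique element, and that element is taken as
    -- ψ m.
    obtain ⟨c, hc⟩ := hC' (θ ∘ₗ ((LinearMap.toSpanSingleton Λ M m) ∘ₗ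
      (traceIdeal Λ P).subtype).codRestrict N fun a => hN m a.1 a.2)
    exact ⟨c, fun a ha => hc ⟨a, ha⟩⟩
  choose ψ hψ using h1
  have huniq : ∀ c c' : C, (∀ a ∈ traceIdeal Λ P, a • c = a • c') → c = c' := fun c c' h =>
    sub_eq_zero.1 (hC _ fun a ha => by rw [smul_sub, h a ha, sub_self])
  refine ⟨{ toFun := ψ, map_add' := fun x y => huniq _ _ fun a ha => ?_,
            map_smul' := fun r x => huniq _ _ fun a ha => ?_ },
    LinearMap.ext fun f => LinearMap.ext fun p => huniq _ _ fun a ha => ?_⟩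
  · rw [smul_add, ← hψ _ _ ha, ← hψ _ _ ha, ← hψ _ _ ha, ← map_add]
    congr 1
    exact Subtype.ext (smul_add _ _ _)
  · have ha' : a * r ∈ traceIdeal Λ P := Ideal.mul_mem_right _ _ ha
    rw [RingHom.id_apply, smul_smul, ← hψ _ _ ha, ← hψ _ _ ha']
    congr 1
    exact Subtype.ext (smul_smul _ _ _)
  · obtain ⟨h, h'⟩ := hθ f (a • p)
    change a • ψ (f p) = _
    rw [← map_smul, ← h', ← hψ _ _ ha]
    congr 1
    exact Subtype.ext (map_smul f a p).symm

/-- A module on which `Ext_Λ(Λ/𝔄, -)` vanishes in all degrees, `𝔄` being the trace of `P`, has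
injective dimension at most that of `Hom_Λ(P, -)`. -/
theorem injDimLT_of_extVanishes_hom [Module.Projective Λ P] [(traceIdeal Λ P).IsTwoSided] (n : ℕ) :
    ∀ (Q : Type u) [AddCommGroup Q] [Module Λ Q],
      (∀ i, ExtVanishes Λ (Λ ⧸ traceIdeal Λ P) Q i) →
      (∀ I : Ideal (Module.End Λ P)ᵐᵒᵖ,
        ExtVanishes (Module.End Λ P)ᵐᵒᵖ ((Module.End Λ P)ᵐᵒᵖ ⧸ I) (P →ₗ[Λ] Q) (n + 1)) →
      InjDimLT Λ Q (n + 1) := by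
  induction n with
  | zero =>
    intro Q _ _ hT hD
    have hQ := (extVanishes_quotient_zero_iff _).1 (hT 0)
    obtain ⟨E, _, _, f, hf⟩ := exists_isInjectiveEnvelope Λ Q
    -- Hom(P, Q) is injective, so its embedding into Hom(P, E) splits. The splitting comes from a
    -- map ψ : E → Q, which makes Q a retract of E.
    obtain ⟨ρ, hρ⟩ := (injective_of_extVanishes_one hD).out (homMap P f)
      (isShortExact_mkQ_range hf.injective).homMap.injective LinearMap.id
    obtain ⟨ψ, rfl⟩ := exists_homMap_eq hQ (exists_smul_eq_of_extVanishes _ (hT 1)) ρ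
    refine injDimLT_one_iff.2 (injective_of_retract hf.injective_module f ψ fun x => ?_)
    -- ψ ∘ f is the identity on images of maps P → Q, in particular on each g q • x; as Q has no
    -- nonzero element killed by the trace, this is enough.
    refine sub_eq_zero.1 (hQ _ fun a ha => smul_eq_zero_of_mem_traceIdeal (fun g q => ?_) ha)
    have h := LinearMap.congr_fun (hρ (g.smulRight x)) q
    have h' : ψ (f (g q • x)) = g q • x := h
    rw [smul_sub, ← map_smul, ← map_smul, h', sub_self]
  | succ n ih =>
    intro Q _ _ hT hD
    have hQ := (extVanishes_quotient_zero_iff _).1 (hT 0)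
    obtain ⟨E, _, _, f, hf⟩ := exists_isInjectiveEnvelope Λ Q
    have hE : ∀ c : E, (∀ a ∈ traceIdeal Λ P, a • c = 0) → c = 0 := by
      -- The part of E killed by 𝔄 meets the image of Q in zero, and that image is essential.
      have hN : annihilatedBy (traceIdeal Λ P) E = ⊥ := by
        refine hf.essential _ ((Submodule.eq_bot_iff _).2 ?_)
        rintro _ ⟨hx, y, rfl⟩
        rw [hQ y fun a ha => hf.injective (by rw [map_smul, hx a ha, map_zero]), map_zero]
      intro c hc
      have : c ∈ annihilatedBy (traceIdeal Λ P) E := hc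
      rwa [hN, Submodule.mem_bot] at this
    have hs := isShortExact_mkQ_range hf.injective
    have hET : ∀ i, ExtVanishes Λ (Λ ⧸ traceIdeal Λ P) E i := by
      rintro (_ | i)
      · exact (extVanishes_quotient_zero_iff _).2 hE
      · exact extVanishes_of_injective hf.injective_module i
    refine hs.injDimLT_left hf.injective_module (ih _ (fun i => ?_) fun I => ?_)
    · exact hs.extVanishes_right (hET i) (hT (i + 1))
    · exact (hs.homMap (P := P)).extVanishes_right
        (extVanishes_of_injective (injective_hom_of_injective hf.injective_module hE) n) (hD I)

theorem injDimLT_of_gldim_le [Module.Projective Λ P] [(traceIdeal Λ P).IsTwoSided] {n : ℕ}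
    (hg : gldim (Module.End Λ P)ᵐᵒᵖ ≤ n) {Q : Type u} [AddCommGroup Q] [Module Λ Q]
    (hQ : ∀ i, ExtVanishes Λ (Λ ⧸ traceIdeal Λ P) Q i) : InjDimLT Λ Q (n + 1) := by
  refine injDimLT_of_extVanishes_hom n Q hQ fun I => ?_
  have h := (le_iSup (fun M : FGModuleCat.{u} (Module.End Λ P)ᵐᵒᵖ => projDim M.obj)
    (FGModuleCat.of _ ((Module.End Λ P)ᵐᵒᵖ ⧸ I))).trans hg
  exact extVanishes_of_hasProjectiveDimensionLT (hasProjectiveDimensionLT_of_projDim_le h) le_rfl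

end

/-! ### Duality into an injective abelian group, and injective Λ/𝔄-modules over Λ. -/

section

variable {Λ : Type u} [Ring Λ] {V : Type u} [AddCommGroup V]

/-- The additive maps `A → V` out of a right `Λ`-module `A`, as a left `Λ`-module. -/
abbrev dualModule (A : Type u) [AddCommGroup A] [Module Λᵐᵒᵖ A] : Module Λ (A →+ V) where
  smul r χ := χ.comp (DistribSMul.toAddMonoidHom A (MulOpposite.op r))
  one_smul χ := AddMonoidHom.ext fun x => congrArg χ (one_smul _ x)
  mul_smul r s χ := AddMonoidHom.ext fun x =>
    congrArg χ (mul_smul (MulOpposite.op s) (MulOpposite.op r) x)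
  smul_zero _ := rfl
  smul_add _ _ _ := rfl
  add_smul r s χ := AddMonoidHom.ext fun x =>
    (congrArg χ (add_smul (MulOpposite.op r) (MulOpposite.op s) x)).trans (map_add χ _ _)
  zero_smul χ := AddMonoidHom.ext fun x =>
    (congrArg χ (zero_smul Λᵐᵒᵖ x)).trans (map_zero χ)

attribute [local instance] dualModule

theorem dualModule_smul_apply {A : Type u} [AddCommGroup A] [Module Λᵐᵒᵖ A] (r : Λ) (χ : A →+ V)
    (x : A) : (r • χ) x = χ (MulOpposite.op r • x) := rfl

/-- The transpose of a map of right `Λ`-modules. -/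
def dualMap (V : Type u) [AddCommGroup V] {A B : Type u} [AddCommGroup A] [Module Λᵐᵒᵖ A]
    [AddCommGroup B] [Module Λᵐᵒᵖ B] (f : A →ₗ[Λᵐᵒᵖ] B) : (B →+ V) →ₗ[Λ] (A →+ V) where
  toFun χ := χ.comp f.toAddMonoidHom
  map_add' _ _ := rfl
  map_smul' r χ := AddMonoidHom.ext fun x => congrArg χ (map_smul f (MulOpposite.op r) x).symm

theorem exists_addMonoidHom_extension (hV : Module.Injective ℤ V) {X Y : Type u} [AddCommGroup X]
    [AddCommGroup Y] (f : X →+ Y) (hf : Function.Injective f) (g : X →+ V) :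
    ∃ h : Y →+ V, ∀ x, h (f x) = g x := by
  obtain ⟨h, hh⟩ := hV.out f.toIntLinearMap hf g.toIntLinearMap
  exact ⟨h.toAddMonoidHom, hh⟩

theorem IsShortExact.dualMap (hV : Module.Injective ℤ V) {A B C : Type u} [AddCommGroup A]
    [Module Λᵐᵒᵖ A] [AddCommGroup B] [Module Λᵐᵒᵖ B] [AddCommGroup C] [Module Λᵐᵒᵖ C]
    {f : A →ₗ[Λᵐᵒᵖ] B} {g : B →ₗ[Λᵐᵒᵖ] C} (h : IsShortExact f g) :
    IsShortExact (dualMap V g) (dualMap V f) where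
  injective χ ψ hχ := AddMonoidHom.ext fun c => by
    obtain ⟨b, rfl⟩ := h.surjective c
    exact DFunLike.congr_fun hχ b
  exact χ := by
    constructor
    · intro hχ
      have hk : ∀ b ∈ LinearMap.ker g, χ b = 0 := by
        intro b hb
        obtain ⟨a, rfl⟩ := (h.exact b).1 hb
        exact DFunLike.congr_fun hχ a
      let φ : (B ⧸ LinearMap.ker g) →+ V :=
        QuotientAddGroup.lift (LinearMap.ker g).toAddSubgroup χ hk
      refine ⟨φ.comp (g.quotKerEquivOfSurjective h.surjective).symm.toAddMonoidHom,
        AddMonoidHom.ext fun b => ?_⟩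
      have hb : (g.quotKerEquivOfSurjective h.surjective).symm (g b) =
          (LinearMap.ker g).mkQ b := by
        rw [LinearEquiv.symm_apply_eq]
        rfl
      change φ ((g.quotKerEquivOfSurjective h.surjective).symm (g b)) = χ b
      rw [hb]
      rfl
    · rintro ⟨ψ, rfl⟩
      exact AddMonoidHom.ext fun a =>
        (congrArg ψ (h.exact.apply_apply_eq_zero a)).trans (map_zero ψ)
  surjective χ := by
    obtain ⟨ψ, hψ⟩ := exists_addMonoidHom_extension hV f.toAddMonoidHom h.injective χ
    exact ⟨ψ, AddMonoidHom.ext hψ⟩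

/-- Evaluation at 1 identifies Λ-linear maps Y → Hom(Λ, V) with additive maps Y → V, so the
extension problem reduces to injectivity of V over ℤ. -/
theorem injective_dual_self (hV : Module.Injective ℤ V) :
    Module.Injective Λ (Λᵐᵒᵖ →+ V) := by
  refine ⟨fun X Y _ _ _ _ f hf g => ?_⟩
  obtain ⟨k, hk⟩ := exists_addMonoidHom_extension hV f.toAddMonoidHom hf
    ((AddMonoidHom.eval (1 : Λᵐᵒᵖ)).comp g.toAddMonoidHom)
  replace hk : ∀ x, k (f x) = g x 1 := hk
  refine ⟨{ toFun := fun y => k.comp ((LinearMap.toSpanSingleton Λ Y y).toAddMonoidHom.comp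
              (MulOpposite.opAddEquiv (α := Λ)).symm.toAddMonoidHom)
            map_add' := fun x y => AddMonoidHom.ext fun r => ?_
            map_smul' := fun s y => AddMonoidHom.ext fun r => ?_ },
    fun x => AddMonoidHom.ext fun r => ?_⟩
  · exact (congrArg k (smul_add r.unop x y)).trans (map_add k _ _)
  · exact congrArg k (smul_smul r.unop s y)
  · change k (r.unop • f x) = g x r
    rw [← map_smul, hk, map_smul, dualModule_smul_apply]
    simp

/-- A section of the free cover of A exhibits the dual of A as a retract of a product of copies of
the dual of Λ. -/
theorem injective_dual_of_projective (hV : Module.Injective ℤ V) (A : Type u) [AddCommGroup A]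
    [Module Λᵐᵒᵖ A] [hA : Module.Projective Λᵐᵒᵖ A] : Module.Injective Λ (A →+ V) := by
  obtain ⟨s, hs⟩ := Module.projective_def'.1 hA
  have := injective_dual_self (Λ := Λ) hV
  refine injective_of_retract (Y := A → (Λᵐᵒᵖ →+ V)) inferInstance
    (LinearMap.pi fun a => dualMap V (LinearMap.toSpanSingleton Λᵐᵒᵖ A a))
    { toFun := fun η => (Finsupp.liftAddHom η).comp s.toAddMonoidHom
      map_add' := fun η ξ => AddMonoidHom.ext fun x => ?_
      map_smul' := fun r η => AddMonoidHom.ext fun x => ?_ } fun χ => AddMonoidHom.ext fun x => ?_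
  · exact Finsupp.sum_add
  · change (s x).sum (fun a t => (r • η a) t) = (s (MulOpposite.op r • x)).sum fun a t => η a t
    rw [map_smul, Finsupp.sum_smul_index' fun a => map_zero (η a)]
    rfl
  · change (s x).sum (fun a t => χ (t • a)) = χ x
    have h : Finsupp.linearCombination Λᵐᵒᵖ id (s x) = x := LinearMap.congr_fun hs x
    conv_rhs => rw [← h, Finsupp.linearCombination_apply, map_finsuppSum]
    rfl

/-- Dualizing is exact and turns a projective resolution into an injective coresolution; the
induction strips off one free cover at a time. -/
theorem injDimLT_dual (hV : Module.Injective ℤ V) (n : ℕ) :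
    ∀ (A : Type u) [AddCommGroup A] [Module Λᵐᵒᵖ A],
      CategoryTheory.HasProjectiveDimensionLT (ModuleCat.of Λᵐᵒᵖ A) (n + 1) →
      InjDimLT Λ (A →+ V) (n + 1) := by
  induction n with
  | zero =>
    intro A _ _ h
    have : Module.Projective Λᵐᵒᵖ A := (IsProjective.iff_projective A).2
      (CategoryTheory.projective_iff_hasProjectiveDimensionLT_one.2 h)
    exact injDimLT_one_iff.2 (injective_dual_of_projective hV A)
  | succ n ih =>
    intro A _ _ h
    let p : (A →₀ Λᵐᵒᵖ) →ₗ[Λᵐᵒᵖ] A := Finsupp.linearCombination Λᵐᵒᵖ id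
    have hp : IsShortExact (A := LinearMap.ker p) (LinearMap.ker p).subtype p :=
      { injective := (LinearMap.ker p).subtype_injective
        exact := LinearMap.exact_subtype_ker_map p
        surjective := Finsupp.linearCombination_id_surjective _ _ }
    have hF : Module.Projective Λᵐᵒᵖ (A →₀ Λᵐᵒᵖ) := inferInstance
    have hK := (hp.shortExact.hasProjectiveDimensionLT_X₃_iff n
      ((IsProjective.iff_projective (A →₀ Λᵐᵒᵖ)).1 hF)).1 h
    exact (hp.dualMap hV).injDimLT_left (injective_dual_of_projective hV _) (ih _ hK)

/-- An injective module over `Λ/𝔄` has injective dimension over `Λ` at most the projective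
dimension of `Λ/𝔄` as a right `Λ`-module. -/
theorem injDimLT_of_injective_quotient (𝔄 : Ideal Λ) [𝔄.IsTwoSided] {n : ℕ}
    (hn : projDim (rightQuotient 𝔄) ≤ n) {J : Type u} [AddCommGroup J] [Module Λ J]
    [Module (Λ ⧸ 𝔄) J] [IsScalarTower Λ (Λ ⧸ 𝔄) J] (hJ : Module.Injective (Λ ⧸ 𝔄) J) :
    InjDimLT Λ J (n + 1) := by
  let Q : ModuleCat.{u} ℤ := CategoryTheory.Injective.under (ModuleCat.of ℤ J)
  let v : J →ₗ[ℤ] Q := (CategoryTheory.Injective.ι (ModuleCat.of ℤ J)).hom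
  have hv : Function.Injective v := (ModuleCat.mono_iff_injective _).1 inferInstance
  have hQ : CategoryTheory.Injective Q := CategoryTheory.Injective.injective_under _
  -- The ℤ-action bundled with Q is replaced by the canonical one; they agree since ℤ-module
  -- structures are unique.
  have hV : @Module.Injective ℤ _ Q _ (AddCommGroup.toIntModule Q) := by
    convert Module.injective_module_of_injective_object (R := ℤ) (M := Q)
    exact Subsingleton.elim _ _
  have hd := injDimLT_dual hV n (rightQuotient 𝔄) (hasProjectiveDimensionLT_of_projDim_le hn)
  -- J embeds Λ/𝔄-linearly into Hom_ℤ(Λ/𝔄, Q) by j ↦ (r ↦ r • j). The embedding splits because J is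
  -- injective, so J is a retract of the dual of the right module Λ/𝔄.
  let i : J →ₗ[Λ ⧸ 𝔄] ((Λ ⧸ 𝔄) →+ Q) :=
    { toFun := fun j => v.toAddMonoidHom.comp
        (LinearMap.toSpanSingleton (Λ ⧸ 𝔄) J j).toAddMonoidHom
      map_add' := fun x y => AddMonoidHom.ext fun r =>
        (congrArg v (smul_add r x y)).trans (map_add v _ _)
      map_smul' := fun s y => AddMonoidHom.ext fun r => congrArg v (smul_smul r s y) }
  have hi : Function.Injective i := by
    intro x y hxy
    have h : v ((1 : Λ ⧸ 𝔄) • x) = v ((1 : Λ ⧸ 𝔄) • y) := DFunLike.congr_fun hxy 1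
    simpa using hv h
  obtain ⟨ρ, hρ⟩ := hJ.out i hi LinearMap.id
  have hsmul : ∀ (r : Λ) (j : J), r • j = Ideal.Quotient.mk 𝔄 r • j := fun r j => by
    conv_lhs => rw [← one_smul (Λ ⧸ 𝔄) j, ← smul_assoc]
    congr 1
    change Ideal.Quotient.mk 𝔄 (r * 1) = _
    rw [mul_one]
  refine hd.of_retract
    { toFun := fun j => i j
      map_add' := map_add i
      map_smul' := fun r j => by
        rw [hsmul, map_smul]
        rfl }
    { toFun := fun χ => ρ χ
      map_add' := map_add ρ
      map_smul' := fun r χ => (ρ.map_smul (Ideal.Quotient.mk 𝔄 r) χ).trans (hsmul r _).symm } hρ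

end

/-! ### The horseshoe lemma and iterated cosyzygies in K₀. -/

section

variable {Λ : Type u} [Ring Λ]

/-- The class `[A]` of an unbundled finitely generated module. -/
abbrev InjK0.cls (Λ : Type u) [Ring Λ] (A : Type u) [AddCommGroup A] [Module Λ A]
    [Module.Finite Λ A] : InjK0 Λ :=
  InjK0.mk (FGModuleCat.of Λ A)

theorem InjK0.cls_congr {A B : Type u} [AddCommGroup A] [Module Λ A] [Module.Finite Λ A]
    [AddCommGroup B] [Module Λ B] [Module.Finite Λ B] (e : A ≃ₗ[Λ] B) :
    InjK0.cls Λ A = InjK0.cls Λ B :=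
  InjK0.mk_congr (C := FGModuleCat.of Λ A) (A := FGModuleCat.of Λ B) e

theorem injective_prod {I J : Type u} [AddCommGroup I] [Module Λ I] [AddCommGroup J] [Module Λ J]
    (hI : Module.Injective Λ I) (hJ : Module.Injective Λ J) : Module.Injective Λ (I × J) := by
  refine ⟨fun X Y _ _ _ _ i hi k => ?_⟩
  obtain ⟨a, ha⟩ := hI.out i hi (LinearMap.fst Λ I J ∘ₗ k)
  obtain ⟨b, hb⟩ := hJ.out i hi (LinearMap.snd Λ I J ∘ₗ k)
  exact ⟨a.prod b, fun x => Prod.ext (ha x) (hb x)⟩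

/-- The horseshoe lemma for embeddings into injective modules. -/
theorem IsShortExact.exists_horseshoe {A B C I E : Type u} [AddCommGroup A] [Module Λ A]
    [AddCommGroup B] [Module Λ B] [AddCommGroup C] [Module Λ C] [AddCommGroup I] [Module Λ I]
    [AddCommGroup E] [Module Λ E] {f : A →ₗ[Λ] B} {g : B →ₗ[Λ] C} (h : IsShortExact f g)
    (hI : Module.Injective Λ I) {a : A →ₗ[Λ] I} (ha : Function.Injective a) {c : C →ₗ[Λ] E}
    (hc : Function.Injective c) :
    ∃ b : B →ₗ[Λ] I × E, Function.Injective b ∧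
      ∃ (i : (I ⧸ LinearMap.range a) →ₗ[Λ] ((I × E) ⧸ LinearMap.range b))
        (q : ((I × E) ⧸ LinearMap.range b) →ₗ[Λ] (E ⧸ LinearMap.range c)), IsShortExact i q := by
  obtain ⟨a', ha'⟩ := hI.out f h.injective a
  have hker : ∀ y, g y = 0 → ∃ x, f x = y := fun y hy => (h.exact y).1 hy
  have hgf : ∀ x, g (f x) = 0 := h.exact.apply_apply_eq_zero
  let b : B →ₗ[Λ] I × E := a'.prod (c ∘ₗ g)
  have hb : ∀ y, b y = (a' y, c (g y)) := fun _ => rfl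
  refine ⟨b, ?_, Submodule.mapQ _ _ (LinearMap.inl Λ I E) ?_,
    Submodule.mapQ _ _ (LinearMap.snd Λ I E) ?_, ?_, ?_, ?_⟩
  · refine (injective_iff_map_eq_zero b).2 fun y hy => ?_
    rw [hb, Prod.mk_eq_zero] at hy
    obtain ⟨x, rfl⟩ := hker y (hc (by rw [hy.2, map_zero]))
    rw [ha'] at hy
    rw [ha (hy.1.trans (map_zero a).symm), map_zero]
  · rintro _ ⟨x, rfl⟩
    exact ⟨f x, by simp [hb, ha', hgf]⟩
  · rintro _ ⟨y, rfl⟩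
    exact ⟨g y, rfl⟩
  · refine (injective_iff_map_eq_zero _).2 fun x hx => ?_
    obtain ⟨x, rfl⟩ := (LinearMap.range a).mkQ_surjective x
    rw [Submodule.mkQ_apply, Submodule.mapQ_apply, Submodule.Quotient.mk_eq_zero] at hx
    obtain ⟨y, hy⟩ := hx
    rw [hb, LinearMap.inl_apply, Prod.mk.injEq] at hy
    obtain ⟨z, rfl⟩ := hker y (hc (by rw [hy.2, map_zero]))
    rw [Submodule.mkQ_apply, Submodule.Quotient.mk_eq_zero]
    exact ⟨z, by rw [← ha', hy.1]⟩
  · intro x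
    obtain ⟨⟨x, e⟩, rfl⟩ := (LinearMap.range b).mkQ_surjective x
    constructor
    · intro hx
      rw [Submodule.mkQ_apply, Submodule.mapQ_apply, Submodule.Quotient.mk_eq_zero] at hx
      obtain ⟨z, hz⟩ := hx
      obtain ⟨y, rfl⟩ := h.surjective z
      -- Subtracting b y from (x, e) clears the second coordinate, since e = c (g y).
      refine ⟨(LinearMap.range a).mkQ (x - a' y), ?_⟩
      rw [Submodule.mkQ_apply, Submodule.mapQ_apply, Submodule.mkQ_apply, Submodule.Quotient.eq]
      refine ⟨-y, ?_⟩
      rw [LinearMap.snd_apply] at hz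
      simp [hb, hz]
    · rintro ⟨y, hy⟩
      obtain ⟨y, rfl⟩ := (LinearMap.range a).mkQ_surjective y
      rw [← hy, Submodule.mkQ_apply, Submodule.mapQ_apply, Submodule.mapQ_apply]
      simp
  · intro e
    obtain ⟨e, rfl⟩ := (LinearMap.range c).mkQ_surjective e
    exact ⟨(LinearMap.range b).mkQ (0, e), rfl⟩

theorem exists_finite_injective_embedding (R : Type w) [CommRing R] [IsArtinianRing R]
    [Algebra R Λ] [Module.Finite R Λ] (A : Type u) [AddCommGroup A] [Module Λ A]
    [Module.Finite Λ A] :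
    ∃ (E : Type u) (_ : AddCommGroup E) (_ : Module Λ E) (f : A →ₗ[Λ] E),
      Module.Finite Λ E ∧ Module.Injective Λ E ∧ Function.Injective f := by
  obtain ⟨E, _, _, f, hf⟩ := exists_isInjectiveEnvelope Λ A
  exact ⟨E, _, _, f, hf.finite R, hf.injective_module, hf.injective⟩

variable (R : Type w) [CommRing R] [IsArtinianRing R] [Algebra R Λ] [Module.Finite R Λ]

theorem cosyzygyHom_cls {A J : Type u} [AddCommGroup A] [Module Λ A]
    [Module.Finite Λ A] [AddCommGroup J] [Module Λ J] [Module.Finite Λ J] {f : A →ₗ[Λ] J}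
    (hf : Function.Injective f) (hJ : Module.Injective Λ J) :
    cosyzygyHom R Λ (InjK0.cls Λ A) = InjK0.cls Λ (J ⧸ LinearMap.range f) := by
  rw [cosyzygyHom_mk]
  exact InjK0.mk_cosyzygy_eq R (M := FGModuleCat.of Λ A) (J := FGModuleCat.of Λ J) f hf hJ

theorem IsShortExact.cosyzygyHom_eq {A J C : Type u} [AddCommGroup A] [Module Λ A]
    [Module.Finite Λ A] [AddCommGroup J] [Module Λ J] [Module.Finite Λ J] [AddCommGroup C]
    [Module Λ C] [Module.Finite Λ C] {f : A →ₗ[Λ] J} {g : J →ₗ[Λ] C} (h : IsShortExact f g)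
    (hJ : Module.Injective Λ J) :
    cosyzygyHom R Λ (InjK0.cls Λ A) = InjK0.cls Λ C := by
  rw [cosyzygyHom_cls R h.injective hJ]
  exact InjK0.cls_congr ((Submodule.quotEquivOfEq _ _ h.exact.linearMap_ker_eq.symm).trans
    (g.quotKerEquivOfSurjective h.surjective))

/-- If `0 → A → B → Q → 0` is exact and `Q` has injective dimension at most `n`, then `A` and `B`
have the same `(n+1)`-st cosyzygies. -/
theorem IsShortExact.iterate_cosyzygyHom_eq (n : ℕ) :
    ∀ {A B Q : Type u} [AddCommGroup A] [Module Λ A] [Module.Finite Λ A] [AddCommGroup B]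
      [Module Λ B] [Module.Finite Λ B] [AddCommGroup Q] [Module Λ Q] [Module.Finite Λ Q]
      {f : A →ₗ[Λ] B} {g : B →ₗ[Λ] Q}, IsShortExact f g → InjDimLT Λ Q (n + 1) →
      (cosyzygyHom R Λ)^[n + 1] (InjK0.cls Λ A) = (cosyzygyHom R Λ)^[n + 1] (InjK0.cls Λ B) := by
  induction n with
  | zero =>
    intro A B Q _ _ _ _ _ _ _ _ _ f g h hQ
    replace hQ := injDimLT_one_iff.1 hQ
    obtain ⟨I, _, _, a, _, hI, ha⟩ := exists_finite_injective_embedding R (Λ := Λ) A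
    -- Q is injective, so it is embedded by the identity. Its cokernel vanishes, and the horseshoe
    -- sequence identifies the cosyzygies of A and B.
    obtain ⟨b, hb, i, q, hs⟩ :=
      h.exists_horseshoe hI ha (c := (LinearMap.id : Q →ₗ[Λ] Q)) Function.injective_id
    rw [zero_add, Function.iterate_one, cosyzygyHom_cls R ha hI,
      cosyzygyHom_cls R hb (injective_prod hI hQ)]
    refine InjK0.cls_congr (LinearEquiv.ofBijective i ⟨hs.injective, fun x => ?_⟩)
    refine (hs.exact x).1 ?_
    obtain ⟨y, hy⟩ := (LinearMap.range (LinearMap.id : Q →ₗ[Λ] Q)).mkQ_surjective (q x)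
    rw [← hy]
    simp
  | succ n ih =>
    intro A B Q _ _ _ _ _ _ _ _ _ f g h hQ
    obtain ⟨I, _, _, a, _, hI, ha⟩ := exists_finite_injective_embedding R (Λ := Λ) A
    obtain ⟨E, _, _, c, _, hE, hc⟩ := exists_finite_injective_embedding R (Λ := Λ) Q
    obtain ⟨b, hb, i, q, hs⟩ := h.exists_horseshoe hI ha hc
    rw [Function.iterate_succ_apply, Function.iterate_succ_apply (n := n + 1),
      cosyzygyHom_cls R ha hI, cosyzygyHom_cls R hb (injective_prod hI hE)]
    exact ih hs ((isShortExact_mkQ_range hc).injDimLT_right hE hQ)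

/-- If `0 → A → J → Y → 0` is exact and `J` has injective dimension at most `n`, then the `n`-th
cosyzygy of `Y` is the `(n+1)`-st cosyzygy of `A`. -/
theorem IsShortExact.iterate_cosyzygyHom_eq_succ (n : ℕ) :
    ∀ {A J Y : Type u} [AddCommGroup A] [Module Λ A] [Module.Finite Λ A] [AddCommGroup J]
      [Module Λ J] [Module.Finite Λ J] [AddCommGroup Y] [Module Λ Y] [Module.Finite Λ Y]
      {f : A →ₗ[Λ] J} {g : J →ₗ[Λ] Y}, IsShortExact f g → InjDimLT Λ J (n + 1) →
      (cosyzygyHom R Λ)^[n] (InjK0.cls Λ Y) = (cosyzygyHom R Λ)^[n + 1] (InjK0.cls Λ A) := by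
  induction n with
  | zero =>
    intro A J Y _ _ _ _ _ _ _ _ _ f g h hJ
    exact (h.cosyzygyHom_eq R (injDimLT_one_iff.1 hJ)).symm
  | succ n ih =>
    intro A J Y _ _ _ _ _ _ _ _ _ f g h hJ
    obtain ⟨I, _, _, a, _, hI, ha⟩ := exists_finite_injective_embedding R (Λ := Λ) A
    obtain ⟨E, _, _, c, _, hE, hc⟩ := exists_finite_injective_embedding R (Λ := Λ) Y
    obtain ⟨b, hb, i, q, hs⟩ := h.exists_horseshoe hI ha hc
    rw [Function.iterate_succ_apply, Function.iterate_succ_apply (n := n + 1),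
      cosyzygyHom_cls R ha hI, cosyzygyHom_cls R hc hE]
    -- The horseshoe embeds J into I × E, and the cokernel has injective dimension one less.
    exact ih hs ((isShortExact_mkQ_range hb).injDimLT_right (injective_prod hI hE) hJ)

theorem iterate_cosyzygyHom_cls_eq_zero (n : ℕ) :
    ∀ (J : Type u) [AddCommGroup J] [Module Λ J] [Module.Finite Λ J], InjDimLT Λ J (n + 1) →
      (cosyzygyHom R Λ)^[n] (InjK0.cls Λ J) = 0 := by
  induction n with
  | zero =>
    intro J _ _ _ hJ
    exact InjK0.mk_eq_zero _ (injDimLT_one_iff.1 hJ)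
  | succ n ih =>
    intro J _ _ _ hJ
    obtain ⟨E, _, _, c, _, hE, hc⟩ := exists_finite_injective_embedding R (Λ := Λ) J
    rw [Function.iterate_succ_apply, cosyzygyHom_cls R hc hE]
    exact ih _ ((isShortExact_mkQ_range hc).injDimLT_right hE hJ)

end

/-! ### The 𝔄-annihilated submodule and restriction of scalars from Λ/𝔄. -/

section

variable {Λ : Type u} [Ring Λ] (𝔄 : Ideal Λ) [𝔄.IsTwoSided]

theorem annihilatedBy_isTorsionBySet (N : Type u) [AddCommGroup N] [Module Λ N] :
    Module.IsTorsionBySet Λ (annihilatedBy 𝔄 N) 𝔄 :=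
  fun x a => Subtype.ext (x.2 a a.2)

instance annihilatedBy.module (N : Type u) [AddCommGroup N] [Module Λ N] :
    Module (Λ ⧸ 𝔄) (annihilatedBy 𝔄 N) :=
  (annihilatedBy_isTorsionBySet 𝔄 N).module

instance annihilatedBy.isScalarTower (N : Type u) [AddCommGroup N] [Module Λ N] :
    IsScalarTower Λ (Λ ⧸ 𝔄) (annihilatedBy 𝔄 N) where
  smul_assoc r s x := by
    obtain ⟨s, rfl⟩ := Ideal.Quotient.mk_surjective s
    exact mul_smul r s x

instance annihilatedBy.finite [IsNoetherianRing Λ] (N : Type u) [AddCommGroup N] [Module Λ N]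
    [Module.Finite Λ N] : Module.Finite (Λ ⧸ 𝔄) (annihilatedBy 𝔄 N) :=
  Module.Finite.of_restrictScalars_finite Λ (Λ ⧸ 𝔄) _

/-- The map induced on the submodules annihilated by `𝔄`. -/
def annihilatedByMap {M N : Type u} [AddCommGroup M] [Module Λ M] [AddCommGroup N] [Module Λ N]
    (f : M →ₗ[Λ] N) : annihilatedBy 𝔄 M →ₗ[Λ ⧸ 𝔄] annihilatedBy 𝔄 N where
  toFun x := ⟨f x, fun a ha => by rw [← map_smul, x.2 a ha, map_zero]⟩
  map_add' x y := Subtype.ext (map_add f _ _)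
  map_smul' r x := by
    obtain ⟨r, rfl⟩ := Ideal.Quotient.mk_surjective r
    exact Subtype.ext (map_smul f r _)

/-- As g b is killed by 𝔄, each a • b comes from A, giving a linear map 𝔄 → A. Vanishing of
Ext¹(Λ/𝔄, A) makes this map multiplication by some y, which is the correction term. -/
theorem exists_sub_mem_annihilatedBy {A B C : Type u} [AddCommGroup A] [Module Λ A]
    [AddCommGroup B] [Module Λ B] [AddCommGroup C] [Module Λ C] {f : A →ₗ[Λ] B} {g : B →ₗ[Λ] C}
    (h : IsShortExact f g) (hA : ExtVanishes Λ (Λ ⧸ 𝔄) A 1) {b : B}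
    (hb : g b ∈ annihilatedBy 𝔄 C) : ∃ y, b - f y ∈ annihilatedBy 𝔄 B := by
  have hr : ∀ a : 𝔄, (a : Λ) • b ∈ LinearMap.range f := fun a =>
    (h.exact _).1 (by rw [map_smul]; exact hb a a.2)
  obtain ⟨y, hy⟩ := exists_smul_eq_of_extVanishes 𝔄 hA
    ((LinearEquiv.ofInjective f h.injective).symm.toLinearMap ∘ₗ
      ((LinearMap.toSpanSingleton Λ B b) ∘ₗ 𝔄.subtype).codRestrict _ hr)
  refine ⟨y, fun a ha => ?_⟩
  have h1 := congrArg f (hy ⟨a, ha⟩)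
  have h2 : f ((LinearEquiv.ofInjective f h.injective).symm ⟨a • b, hr ⟨a, ha⟩⟩) = a • b :=
    congrArg Subtype.val
      ((LinearEquiv.ofInjective f h.injective).apply_symm_apply ⟨a • b, hr ⟨a, ha⟩⟩)
  rw [smul_sub, ← map_smul f, ← h1, sub_eq_zero]
  exact h2.symm

theorem IsShortExact.annihilatedByMap {A B C : Type u} [AddCommGroup A] [Module Λ A]
    [AddCommGroup B] [Module Λ B] [AddCommGroup C] [Module Λ C] {f : A →ₗ[Λ] B} {g : B →ₗ[Λ] C}
    (h : IsShortExact f g) (hA : ExtVanishes Λ (Λ ⧸ 𝔄) A 1) :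
    IsShortExact (annihilatedByMap 𝔄 f) (annihilatedByMap 𝔄 g) where
  injective x y hxy := Subtype.ext (h.injective (congrArg Subtype.val hxy))
  exact x := by
    constructor
    · intro hx
      obtain ⟨y, hy⟩ := (h.exact x.1).1 (congrArg Subtype.val hx)
      refine ⟨⟨y, fun a ha => h.injective ?_⟩, Subtype.ext hy⟩
      rw [map_smul, hy, x.2 a ha, map_zero]
    · rintro ⟨y, rfl⟩
      exact Subtype.ext (h.exact.apply_apply_eq_zero y.1)
  surjective c := by
    obtain ⟨b, hb⟩ := h.surjective c.1
    obtain ⟨y, hy⟩ := exists_sub_mem_annihilatedBy 𝔄 h hA (b := b) (hb ▸ c.2)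
    refine ⟨⟨_, hy⟩, Subtype.ext ?_⟩
    change g (b - f y) = c.1
    rw [map_sub, hb, h.exact.apply_apply_eq_zero, sub_zero]

/-- A `Λ/𝔄`-module, regarded as a `Λ`-module. -/
def Res (_ : Ideal Λ) (X : Type u) : Type u := X

namespace Res

variable {X Y : Type u} [AddCommGroup X] [AddCommGroup Y] [Module (Λ ⧸ 𝔄) X] [Module (Λ ⧸ 𝔄) Y]

instance : AddCommGroup (Res 𝔄 X) := inferInstanceAs (AddCommGroup X)

instance : Module (Λ ⧸ 𝔄) (Res 𝔄 X) := inferInstanceAs (Module (Λ ⧸ 𝔄) X)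

instance : Module Λ (Res 𝔄 X) := Module.compHom X (Ideal.Quotient.mk 𝔄)

instance : IsScalarTower Λ (Λ ⧸ 𝔄) (Res 𝔄 X) where
  smul_assoc r s x := by
    obtain ⟨s, rfl⟩ := Ideal.Quotient.mk_surjective s
    exact mul_smul (Ideal.Quotient.mk 𝔄 r) (Ideal.Quotient.mk 𝔄 s) (show X from x)

instance [Module.Finite (Λ ⧸ 𝔄) X] : Module.Finite Λ (Res 𝔄 X) :=
  have : Module.Finite (Λ ⧸ 𝔄) (Res 𝔄 X) := ‹Module.Finite (Λ ⧸ 𝔄) X›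
  Module.Finite.trans (Λ ⧸ 𝔄) _

/-- A map of `Λ/𝔄`-modules, regarded as a map of `Λ`-modules. -/
def map (f : X →ₗ[Λ ⧸ 𝔄] Y) : Res 𝔄 X →ₗ[Λ] Res 𝔄 Y where
  toFun := f
  map_add' := map_add f
  map_smul' r x := map_smul f (Ideal.Quotient.mk 𝔄 r) (show X from x)

theorem isShortExact {Z : Type u} [AddCommGroup Z] [Module (Λ ⧸ 𝔄) Z] {f : X →ₗ[Λ ⧸ 𝔄] Y}
    {g : Y →ₗ[Λ ⧸ 𝔄] Z} (h : IsShortExact f g) : IsShortExact (map 𝔄 f) (map 𝔄 g) :=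
  ⟨h.injective, h.exact, h.surjective⟩

end Res

/-- Taking 𝔄-annihilated elements is right adjoint to restriction of scalars, which preserves
injections: any Λ-map from a Λ/𝔄-module to I lands in them. -/
theorem injective_annihilatedBy {I : Type u} [AddCommGroup I] [Module Λ I]
    (hI : Module.Injective Λ I) : Module.Injective (Λ ⧸ 𝔄) (annihilatedBy 𝔄 I) := by
  refine ⟨fun X Y _ _ _ _ i hi k => ?_⟩
  obtain ⟨l, hl⟩ := hI.out (Res.map 𝔄 i) hi
    ({ toFun := fun x => k x
       map_add' := fun x y => congrArg Subtype.val (map_add k x y)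
       map_smul' := fun r x => congrArg Subtype.val
        (map_smul k (Ideal.Quotient.mk 𝔄 r) (show X from x)) } : Res 𝔄 X →ₗ[Λ] I)
  have hmem : ∀ y : Res 𝔄 Y, l y ∈ annihilatedBy 𝔄 I := fun y a ha => by
    have h : a • y = 0 := by
      change Ideal.Quotient.mk 𝔄 a • (show Y from y) = 0
      rw [Ideal.Quotient.eq_zero_iff_mem.2 ha, zero_smul]
    rw [← map_smul, h, map_zero]
  refine ⟨{ toFun := fun y => ⟨l y, hmem y⟩
            map_add' := fun x y => Subtype.ext (map_add l x y)
            map_smul' := fun r y => ?_ }, fun x => Subtype.ext (hl x)⟩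
  obtain ⟨r, rfl⟩ := Ideal.Quotient.mk_surjective r
  exact Subtype.ext (map_smul l r (show Res 𝔄 Y from y))

/-- The isomorphism `(M × N)^𝔄 ≃ M^𝔄 × N^𝔄`. -/
def annihilatedByProd {C M N : Type u} [AddCommGroup C] [Module Λ C] [AddCommGroup M] [Module Λ M]
    [AddCommGroup N] [Module Λ N] (e : C ≃ₗ[Λ] M × N) :
    annihilatedBy 𝔄 C ≃ₗ[Λ ⧸ 𝔄] annihilatedBy 𝔄 M × annihilatedBy 𝔄 N where
  __ := (annihilatedByMap 𝔄 (LinearMap.fst Λ M N ∘ₗ e.toLinearMap)).prod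
    (annihilatedByMap 𝔄 (LinearMap.snd Λ M N ∘ₗ e.toLinearMap))
  invFun x := ⟨e.symm (x.1, x.2), fun a ha => by
    rw [← map_smul, Prod.smul_mk, x.1.2 a ha, x.2.2 a ha]
    exact map_zero e.symm⟩
  left_inv x := Subtype.ext (e.symm_apply_apply x.1)
  right_inv x := Prod.ext (Subtype.ext (congrArg Prod.fst (e.apply_symm_apply (x.1.1, x.2.1))))
    (Subtype.ext (congrArg Prod.snd (e.apply_symm_apply (x.1.1, x.2.1))))

theorem InjK0.induction_on {p : InjK0 Λ → Prop} (x : InjK0 Λ)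
    (mk : ∀ (M : Type u) [AddCommGroup M] [Module Λ M] [Module.Finite Λ M], p (InjK0.cls Λ M))
    (add : ∀ x y, p x → p y → p (x + y)) (neg : ∀ x, p x → p (-x)) : p x := by
  obtain ⟨x, rfl⟩ := QuotientAddGroup.mk_surjective x
  induction x using FreeAbelianGroup.induction_on with
  | zero =>
    have h := add _ _ (mk PUnit) (neg _ (mk PUnit))
    rwa [add_neg_cancel] at h
  | of M => exact mk M
  | neg M _ => exact neg _ (mk M)
  | add x y hx hy => exact add _ _ hx hy

/-- The homomorphism `[M] ↦ [M^𝔄]`, `M^𝔄` being the submodule annihilated by `𝔄`. -/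
def annihilatedByHom [IsNoetherianRing Λ] : InjK0 Λ →+ InjK0 (Λ ⧸ 𝔄) :=
  QuotientAddGroup.lift (injK0Relations Λ)
    (FreeAbelianGroup.lift fun M : FGModuleCat.{u} Λ =>
      InjK0.cls (Λ ⧸ 𝔄) (annihilatedBy 𝔄 M)) (by
      refine (AddSubgroup.closure_le _).2 ?_
      rintro x (⟨A, B, C, ⟨e⟩, rfl⟩ | ⟨I, hI, rfl⟩)
      · have h := InjK0.mk_eq_add (A := FGModuleCat.of (Λ ⧸ 𝔄) (annihilatedBy 𝔄 A))
          (B := FGModuleCat.of (Λ ⧸ 𝔄) (annihilatedBy 𝔄 B))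
          (C := FGModuleCat.of (Λ ⧸ 𝔄) (annihilatedBy 𝔄 C)) (annihilatedByProd 𝔄 e)
        simp [h]
      · have h := InjK0.mk_eq_zero (FGModuleCat.of (Λ ⧸ 𝔄) (annihilatedBy 𝔄 I))
          (injective_annihilatedBy 𝔄 hI)
        simp [h])

theorem annihilatedByHom_cls [IsNoetherianRing Λ] (M : Type u) [AddCommGroup M] [Module Λ M]
    [Module.Finite Λ M] :
    annihilatedByHom 𝔄 (InjK0.cls Λ M) = InjK0.cls (Λ ⧸ 𝔄) (annihilatedBy 𝔄 M) := by
  simp [annihilatedByHom, InjK0.cls, InjK0.mk]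

end

/-! ### The homomorphism from K₀(Λ/𝔄) to K₀(Λ). -/

section

variable (R : Type w) [CommRing R] [IsArtinianRing R] {Λ : Type u} [Ring Λ] [Algebra R Λ]
  [Module.Finite R Λ] (𝔄 : Ideal Λ) [𝔄.IsTwoSided]

/-- The homomorphism `[X] ↦ [Ω⁻ᵉ X]` from `Λ/𝔄`-modules to `Λ`-modules, when injective
`Λ/𝔄`-modules have injective dimension at most `e` over `Λ`. -/
noncomputable def resCosyzygyHom {e : ℕ} (he : projDim (rightQuotient 𝔄) ≤ e) :
    InjK0 (Λ ⧸ 𝔄) →+ InjK0 Λ :=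
  QuotientAddGroup.lift (injK0Relations (Λ ⧸ 𝔄))
    (FreeAbelianGroup.lift fun X : FGModuleCat.{u} (Λ ⧸ 𝔄) =>
      (cosyzygyHom R Λ)^[e] (InjK0.cls Λ (Res 𝔄 X))) (by
      refine (AddSubgroup.closure_le _).2 ?_
      rintro x (⟨A, B, C, ⟨e⟩, rfl⟩ | ⟨I, hI, rfl⟩)
      · have e' : Res 𝔄 C ≃ₗ[Λ] (Res 𝔄 A × Res 𝔄 B) :=
          { __ := e.toAddEquiv
            map_smul' := fun r x => map_smul e (Ideal.Quotient.mk 𝔄 r) (show C from x) }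
        have h : InjK0.cls Λ (Res 𝔄 C) = InjK0.cls Λ (Res 𝔄 A) + InjK0.cls Λ (Res 𝔄 B) :=
          InjK0.mk_eq_add (A := FGModuleCat.of Λ (Res 𝔄 A))
          (B := FGModuleCat.of Λ (Res 𝔄 B)) (C := FGModuleCat.of Λ (Res 𝔄 C)) e'
        simp [h, iterate_map_add]
      -- An injective Λ/𝔄-module need not be injective over Λ, but its e-th cosyzygy is zero in K₀;
      -- hence the shift by e.
      · have h := iterate_cosyzygyHom_cls_eq_zero R e (Res 𝔄 I)
          (injDimLT_of_injective_quotient 𝔄 he (J := Res 𝔄 I) hI)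
        simp [h])

variable {e : ℕ} (he : projDim (rightQuotient 𝔄) ≤ e)

theorem resCosyzygyHom_cls (X : Type u) [AddCommGroup X] [Module (Λ ⧸ 𝔄) X]
    [Module.Finite (Λ ⧸ 𝔄) X] :
    resCosyzygyHom R 𝔄 he (InjK0.cls (Λ ⧸ 𝔄) X) =
      (cosyzygyHom R Λ)^[e] (InjK0.cls Λ (Res 𝔄 X)) := by
  simp [resCosyzygyHom, InjK0.cls, InjK0.mk]

/-- An injective embedding X → E over Λ/𝔄 restricts to one whose middle term has injective dimension
at most e, so the e-th cosyzygy of E/X is the (e+1)-st cosyzygy of X. -/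
theorem resCosyzygyHom_cosyzygyHom (y : InjK0 (Λ ⧸ 𝔄)) :
    resCosyzygyHom R 𝔄 he (cosyzygyHom R (Λ ⧸ 𝔄) y) =
      cosyzygyHom R Λ (resCosyzygyHom R 𝔄 he y) := by
  induction y using InjK0.induction_on with
  | mk X =>
    obtain ⟨E, _, _, f, _, hE, hf⟩ := exists_finite_injective_embedding R (Λ := Λ ⧸ 𝔄) X
    rw [cosyzygyHom_cls R hf hE, resCosyzygyHom_cls, resCosyzygyHom_cls,
      ← Function.iterate_succ_apply' (cosyzygyHom R Λ)]
    exact (Res.isShortExact 𝔄 (isShortExact_mkQ_range hf)).iterate_cosyzygyHom_eq_succ R e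
      (injDimLT_of_injective_quotient 𝔄 he (J := Res 𝔄 E) hE)
  | add x y hx hy => simp only [map_add, hx, hy]
  | neg x hx => simp only [map_neg, hx]

end

/-! ### Strong idempotency as a vanishing statement. -/

section

open CategoryTheory CategoryTheory.Abelian

theorem subsingleton_ext_of_iso {Λ : Type u} [Ring Λ] {X X' Y Y' : ModuleCat.{u} Λ} (a : X ≅ X')
    (b : Y ≅ Y') {n : ℕ} (h : Subsingleton (Ext X Y n)) : Subsingleton (Ext X' Y' n) := by
  refine subsingleton_of_forall_eq 0 fun x => ?_
  have h1 : ((Ext.mk₀ a.hom).comp x (zero_add n)).comp (Ext.mk₀ b.inv) (add_zero n) = 0 :=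
    h.elim _ _
  have h2 : (Ext.mk₀ a.hom).comp x (zero_add n) = 0 := by
    have h3 := congrArg (fun z => Ext.comp z (Ext.mk₀ b.hom) (add_zero n)) h1
    simpa using h3
  have h4 := congrArg (fun z => (Ext.mk₀ a.inv).comp z (zero_add n)) h2
  simpa using h4

/-- For a strong idempotent ideal `𝔄`, the modules killed by `𝔄` have no higher extensions by
`Λ/𝔄`. -/
theorem IsStrongIdempotentIdeal.extVanishes {Λ : Type u} [Ring Λ] [IsNoetherianRing Λ]
    {𝔄 : Ideal Λ} [𝔄.IsTwoSided] (h : IsStrongIdempotentIdeal 𝔄) (N : Type u) [AddCommGroup N]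
    [Module Λ N] [Module.Finite Λ N] (i : ℕ) :
    ExtVanishes Λ (Λ ⧸ 𝔄) (annihilatedBy 𝔄 N) (i + 1) := by
  have h1 := h.2 (FGModuleCat.of (Λ ⧸ 𝔄) (Λ ⧸ 𝔄))
    (FGModuleCat.of (Λ ⧸ 𝔄) (annihilatedBy 𝔄 N)) (i + 1)
  -- Over Λ/𝔄 the first argument is free, so Ext vanishes there; the canonical isomorphism carries
  -- the vanishing to Λ.
  have h2 : Subsingleton (Ext (FGModuleCat.of (Λ ⧸ 𝔄) (Λ ⧸ 𝔄)).obj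
      (FGModuleCat.of (Λ ⧸ 𝔄) (annihilatedBy 𝔄 N)).obj (i + 1)) :=
    extVanishes_of_projective (Λ := Λ ⧸ 𝔄) (X := Λ ⧸ 𝔄) (Y := annihilatedBy 𝔄 N) inferInstance i
  have h3 := h1.2.subsingleton
  let a : Res 𝔄 (Λ ⧸ 𝔄) ≃ₗ[Λ] (Λ ⧸ 𝔄) :=
    { AddEquiv.refl (Λ ⧸ 𝔄) with
      map_smul' := fun r x => by
        obtain ⟨x, rfl⟩ := Ideal.Quotient.mk_surjective x
        rfl }
  let b : Res 𝔄 (annihilatedBy 𝔄 N) ≃ₗ[Λ] annihilatedBy 𝔄 N :=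
    { AddEquiv.refl (annihilatedBy 𝔄 N) with
      map_smul' := fun r x => rfl }
  exact subsingleton_ext_of_iso a.toModuleIso b.toModuleIso h3

end

/-! ### Comparing cosyzygies over Λ and over Λ/𝔄. -/

section

variable (R : Type w) [CommRing R] [IsArtinianRing R] {Λ : Type u} [Ring Λ] [Algebra R Λ]
  [Module.Finite R Λ]

/-- Dimension shifting for iterated cosyzygies. -/
theorem exists_iterate_cosyzygyHom_cls_eq (X : Type u) [AddCommGroup X] [Module Λ X] (d : ℕ) :
    ∀ (M : Type u) [AddCommGroup M] [Module Λ M] [Module.Finite Λ M],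
      ∃ (N : Type u) (_ : AddCommGroup N) (_ : Module Λ N) (_ : Module.Finite Λ N),
        (cosyzygyHom R Λ)^[d] (InjK0.cls Λ M) = InjK0.cls Λ N ∧
        ∀ i, ExtVanishes Λ X M (i + 1 + d) → ExtVanishes Λ X N (i + 1) := by
  induction d with
  | zero => exact fun M _ _ _ => ⟨M, _, _, ‹_›, rfl, fun i h => h⟩
  | succ d ih =>
    intro M _ _ _
    obtain ⟨E, _, _, f, _, hE, hf⟩ := exists_finite_injective_embedding R (Λ := Λ) M
    obtain ⟨N, _, _, hN, h1, h2⟩ := ih (E ⧸ LinearMap.range f)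
    refine ⟨N, _, _, hN, ?_, fun i h => h2 i ?_⟩
    · rw [Function.iterate_succ_apply, cosyzygyHom_cls R hf hE, h1]
    · refine (isShortExact_mkQ_range hf).extVanishes_right ?_ h
      rw [add_right_comm]
      exact extVanishes_of_injective hE _

variable (𝔄 : Ideal Λ) [𝔄.IsTwoSided]

/-- Vanishing of Ext¹(Λ/𝔄, N) keeps 0 → N → E → E/N → 0 exact on 𝔄-annihilated parts, with injective
middle term. The cosyzygy E/N inherits the vanishing in all positive degrees. -/
theorem annihilatedByHom_iterate_cosyzygyHom [IsNoetherianRing Λ] (k : ℕ) :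
    ∀ (N : Type u) [AddCommGroup N] [Module Λ N] [Module.Finite Λ N],
      (∀ i, ExtVanishes Λ (Λ ⧸ 𝔄) N (i + 1)) →
      annihilatedByHom 𝔄 ((cosyzygyHom R Λ)^[k] (InjK0.cls Λ N)) =
        (cosyzygyHom R (Λ ⧸ 𝔄))^[k] (annihilatedByHom 𝔄 (InjK0.cls Λ N)) := by
  induction k with
  | zero => exact fun _ _ _ _ _ => rfl
  | succ k ih =>
    intro N _ _ _ hN
    obtain ⟨E, _, _, f, _, hE, hf⟩ := exists_finite_injective_embedding R (Λ := Λ) N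
    have hs := isShortExact_mkQ_range hf
    rw [Function.iterate_succ_apply, Function.iterate_succ_apply, cosyzygyHom_cls R hf hE,
      ih _ fun i => hs.extVanishes_right (extVanishes_of_injective hE i) (hN (i + 1)),
      annihilatedByHom_cls, annihilatedByHom_cls,
      (hs.annihilatedByMap 𝔄 (hN 0)).cosyzygyHom_eq R (injective_annihilatedBy 𝔄 hE)]

variable {𝔄} in
-- The quotient of N by its 𝔄-annihilated part has injective dimension at most g, so it does not
-- affect cosyzygies from degree g + 1 on. Of the t cosyzygies, e are absorbed in `resCosyzygyHom`.
theorem iterate_cosyzygyHom_eq_resCosyzygyHom [IsNoetherianRing Λ]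
    (h𝔄 : IsStrongIdempotentIdeal 𝔄) {P : Type u} [AddCommGroup P] [Module Λ P]
    [Module.Projective Λ P] (hP : traceIdeal Λ P = 𝔄) {g e : ℕ}
    (hg : gldim (Module.End Λ P)ᵐᵒᵖ ≤ g) (he : projDim (rightQuotient 𝔄) ≤ e)
    (N : Type u) [AddCommGroup N] [Module Λ N] [Module.Finite Λ N]
    (hN : ∀ i, ExtVanishes Λ (Λ ⧸ 𝔄) N (i + 1)) {t : ℕ} (hgt : g + 1 ≤ t) (het : e ≤ t) :
    (cosyzygyHom R Λ)^[t] (InjK0.cls Λ N) =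
      (cosyzygyHom R Λ)^[t - e]
        (resCosyzygyHom R 𝔄 he (annihilatedByHom 𝔄 (InjK0.cls Λ N))) := by
  subst hP
  have hs := isShortExact_subtype_mkQ (annihilatedBy (traceIdeal Λ P) N)
  have hA := h𝔄.extVanishes N
  have hQ : ∀ i, ExtVanishes Λ (Λ ⧸ traceIdeal Λ P) (N ⧸ annihilatedBy (traceIdeal Λ P) N) i := by
    rintro (_ | i)
    -- An element of the quotient killed by 𝔄 lifts to an element of N killed by 𝔄, hence is zero.
    · refine (extVanishes_quotient_zero_iff _).2 fun y hy => ?_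
      obtain ⟨x, rfl⟩ := hs.surjective y
      obtain ⟨z, hz⟩ := exists_sub_mem_annihilatedBy _ hs (hA 0) hy
      have hx := add_mem hz z.2
      rw [Submodule.subtype_apply, sub_add_cancel] at hx
      simpa using hx
    · exact hs.extVanishes_right (hN i) (hA (i + 1))
  have h1 := hs.iterate_cosyzygyHom_eq R g (injDimLT_of_gldim_le hg hQ)
  obtain ⟨k, rfl⟩ := Nat.exists_eq_add_of_le' hgt
  have h2 : InjK0.cls Λ (Res (traceIdeal Λ P) (annihilatedBy (traceIdeal Λ P) N)) =
      InjK0.cls Λ (annihilatedBy (traceIdeal Λ P) N) :=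
    InjK0.cls_congr { AddEquiv.refl _ with map_smul' := fun _ _ => rfl }
  rw [annihilatedByHom_cls, resCosyzygyHom_cls, ← Function.iterate_add_apply,
    Nat.sub_add_cancel het, h2, Function.iterate_add_apply, ← h1, ← Function.iterate_add_apply]

/-! ### The φ_r-dimension in terms of kernels of iterated cosyzygies. -/

theorem addSpan_mono_of_equiv {A M B : FGModuleCat.{u} Λ} (e : M ≃ₗ[Λ] (A × B)) :
    addSpan A ≤ addSpan M := by
  refine AddSubgroup.closure_mono ?_
  rintro x ⟨X, ⟨h1, h2, Y, ⟨e'⟩⟩, rfl⟩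
  exact ⟨X, ⟨h1, h2, FGModuleCat.of Λ (Y × B),
    ⟨(e.trans (e'.prodCongr (LinearEquiv.refl Λ B))).trans (LinearEquiv.prodAssoc Λ X Y B)⟩⟩, rfl⟩

/-- Induction on length: a decomposable module splits into two nonzero summands, each of smaller
length. -/
theorem mk_mem_addSpan [IsNoetherianRing Λ] [IsArtinianRing Λ] (M : FGModuleCat.{u} Λ) :
    InjK0.mk M ∈ addSpan M := by
  have hfin : ∀ A : FGModuleCat.{u} Λ, Module.length Λ A ≠ ⊤ := fun A =>
    Module.length_ne_top_iff.2 (isFiniteLength_iff_isNoetherian_isArtinian.2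
      ⟨inferInstance, inferInstance⟩)
  induction hn : Module.length Λ M using WellFoundedLT.induction generalizing M with
  | ind n ih =>
  rcases subsingleton_or_nontrivial M with hM | hM
  · rw [InjK0.mk_eq_zero M (injective_of_subsingleton Λ M)]
    exact zero_mem _
  by_cases hind : ∀ A B : FGModuleCat.{u} Λ, Nonempty (M ≃ₗ[Λ] (A × B)) →
      Subsingleton A ∨ Subsingleton B
  · exact AddSubgroup.subset_closure ⟨M, ⟨hM, hind, FGModuleCat.of Λ PUnit.{u + 1},
      ⟨(LinearEquiv.prodUnique (R := Λ) (M := M) (M₂ := PUnit.{u + 1})).symm⟩⟩, rfl⟩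
  · push Not at hind
    obtain ⟨A, B, ⟨e⟩, hA, hB⟩ := hind
    have hl : n = Module.length Λ A + Module.length Λ B := by
      rw [← hn, e.length_eq, Module.length_prod]
    have hA' := Module.length_pos_iff (R := Λ) (M := A)
    have hB' := Module.length_pos_iff (R := Λ) (M := B)
    rw [InjK0.mk_eq_add e]
    refine add_mem (addSpan_mono_of_equiv e (ih _ ?_ A rfl))
      (addSpan_mono_of_equiv (e.trans (LinearEquiv.prodComm Λ A B)) (ih _ ?_ B rfl))
    · rw [hl, add_comm]
      exact ENat.lt_add_left (hfin A) (hB'.2 hB)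
    · rw [hl]
      exact ENat.lt_add_left (hfin B) (hA'.2 hA)

theorem exists_mem_addSpan [IsNoetherianRing Λ] [IsArtinianRing Λ] (x : InjK0 Λ) :
    ∃ M : FGModuleCat.{u} Λ, x ∈ addSpan M := by
  induction x using InjK0.induction_on with
  | mk M => exact ⟨_, mk_mem_addSpan _⟩
  | add x y hx hy =>
    obtain ⟨M, hM⟩ := hx
    obtain ⟨N, hN⟩ := hy
    exact ⟨FGModuleCat.of Λ (M × N), add_mem
      (addSpan_mono_of_equiv (LinearEquiv.refl Λ (M × N)) hM)
      (addSpan_mono_of_equiv (LinearEquiv.prodComm Λ M N) hN)⟩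
  | neg x hx => exact ⟨hx.choose, neg_mem hx.choose_spec⟩

theorem cosyzygyAddSpan_succ (M : FGModuleCat.{u} Λ) (s : ℕ) :
    cosyzygyAddSpan R M (s + 1) = (cosyzygyAddSpan R M s).map (cosyzygyHom R Λ) :=
  Function.iterate_succ_apply' _ _ _

theorem iterate_mem_cosyzygyAddSpan {M : FGModuleCat.{u} Λ} {x : InjK0 Λ} (hx : x ∈ addSpan M)
    (s : ℕ) : (cosyzygyHom R Λ)^[s] x ∈ cosyzygyAddSpan R M s := by
  induction s with
  | zero => exact hx
  | succ s ih =>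
    rw [cosyzygyAddSpan_succ, Function.iterate_succ_apply']
    exact AddSubgroup.mem_map_of_mem _ ih

theorem exists_iterate_of_mem_cosyzygyAddSpan {M : FGModuleCat.{u} Λ} (s : ℕ) :
    ∀ {x : InjK0 Λ}, x ∈ cosyzygyAddSpan R M s → ∃ y, (cosyzygyHom R Λ)^[s] y = x := by
  induction s with
  | zero => exact fun {x} _ => ⟨x, rfl⟩
  | succ s ih =>
    intro x hx
    rw [cosyzygyAddSpan_succ] at hx
    obtain ⟨z, hz, rfl⟩ := hx
    obtain ⟨y, rfl⟩ := ih hz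
    exact ⟨y, Function.iterate_succ_apply' _ _ _⟩

/-- Every class lies in some ⟨add M⟩, and from the p-th image on Ω⁻¹ is injective there, so
vanishing descends to the p-th iterate. -/
theorem iterate_cosyzygyHom_eq_zero_of_phiRDim_le {p : ℕ} (hp : phiRDim R Λ ≤ p) (x : InjK0 Λ)
    {k : ℕ} (hx : (cosyzygyHom R Λ)^[k] x = 0) : (cosyzygyHom R Λ)^[p] x = 0 := by
  have : IsNoetherian R Λ := inferInstance
  have : IsArtinian R Λ := inferInstance
  have : IsNoetherianRing Λ := isNoetherian_of_tower R inferInstance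
  have : IsArtinianRing Λ := isArtinian_of_tower R inferInstance
  obtain ⟨M, hM⟩ := exists_mem_addSpan x
  -- The strict bound on the infimum yields an actual admissible n < p + 1.
  have hlt : phiR R M < (p : ℕ∞) + 1 :=
    (ENat.lt_add_one_iff (ENat.natCast_ne_top p)).2
      ((le_iSup (fun M : FGModuleCat.{u} Λ => phiR R M) M).trans hp)
  simp only [phiR, iInf_lt_iff] at hlt
  obtain ⟨n, hn, hnp⟩ := hlt
  replace hnp : n ≤ p := Nat.lt_succ_iff.1 (by exact_mod_cast hnp)
  have key : ∀ j, (cosyzygyHom R Λ)^[p + j] x = 0 → (cosyzygyHom R Λ)^[p] x = 0 := by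
    intro j
    induction j with
    | zero => exact id
    | succ j ih =>
      intro h
      refine ih ((hn (p + j) (by omega)).injOn (iterate_mem_cosyzygyAddSpan R hM _)
        (zero_mem _) ?_)
      rw [map_zero, ← Function.iterate_succ_apply' (cosyzygyHom R Λ)]
      exact h
  refine key k ?_
  rw [Function.iterate_add_apply, hx, iterate_map_zero]

/-- Ω⁻¹ is onto the next subgroup by construction. A difference of two elements of the s-th subgroup
with equal images is an s-th iterate killed by Ω⁻¹. -/
theorem phiRDim_le_of_iterate_eq_zero {n : ℕ}
    (h : ∀ s, n ≤ s → ∀ x : InjK0 Λ, (cosyzygyHom R Λ)^[s + 1] x = 0 →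
      (cosyzygyHom R Λ)^[s] x = 0) : phiRDim R Λ ≤ n := by
  refine iSup_le fun M => iInf₂_le n fun s hs => ⟨?_, ?_, ?_⟩
  · intro x hx
    rw [cosyzygyAddSpan_succ]
    exact AddSubgroup.mem_map_of_mem _ hx
  · intro x hx y hy hxy
    obtain ⟨z, hz⟩ := exists_iterate_of_mem_cosyzygyAddSpan R s (sub_mem hx hy)
    rw [← sub_eq_zero, ← hz]
    refine h s hs z ?_
    rw [Function.iterate_succ_apply', hz, map_sub, hxy, sub_self]
  · intro x hx
    rw [cosyzygyAddSpan_succ] at hx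
    exact hx

/-! ### The inequality. -/

theorem phiRDim_le_of_le (h𝔄 : IsStrongIdempotentIdeal 𝔄) (P : Type u) [AddCommGroup P] [Module Λ P]
    [Module.Projective Λ P] (hP : traceIdeal Λ P = 𝔄) {d g e p : ℕ}
    (hd : projDim (leftQuotient 𝔄) ≤ d) (hg : gldim (Module.End Λ P)ᵐᵒᵖ ≤ g)
    (he : projDim (rightQuotient 𝔄) ≤ e) (hp : phiRDim R (Λ ⧸ 𝔄) ≤ p) :
    phiRDim R Λ ≤ (d + max (g + 1) (e + p) : ℕ) := by
  have : IsNoetherianRing Λ := isNoetherian_of_tower R inferInstance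
  have hN : ∀ (M : Type u) [AddCommGroup M] [Module Λ M] [Module.Finite Λ M],
      ∃ (N : Type u) (_ : AddCommGroup N) (_ : Module Λ N) (_ : Module.Finite Λ N),
        (cosyzygyHom R Λ)^[d] (InjK0.cls Λ M) = InjK0.cls Λ N ∧
        ∀ i, ExtVanishes Λ (Λ ⧸ 𝔄) N (i + 1) := by
    intro M _ _ _
    obtain ⟨N, _, _, _, h1, h2⟩ := exists_iterate_cosyzygyHom_cls_eq R (Λ := Λ) (Λ ⧸ 𝔄) d M
    exact ⟨N, _, _, ‹_›, h1, fun i => h2 i (extVanishes_of_hasProjectiveDimensionLT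
      (hasProjectiveDimensionLT_of_projDim_le hd) (by omega))⟩
  -- Both sides are additive in x, so this and the next identity need checking only on classes of
  -- modules, where `hN` supplies N.
  have hF : ∀ (k : ℕ) (x : InjK0 Λ), annihilatedByHom 𝔄 ((cosyzygyHom R Λ)^[k + d] x) =
      (cosyzygyHom R (Λ ⧸ 𝔄))^[k] (annihilatedByHom 𝔄 ((cosyzygyHom R Λ)^[d] x)) := by
    intro k x
    induction x using InjK0.induction_on with
    | mk M =>
      obtain ⟨N, _, _, _, h1, h2⟩ := hN M
      rw [Function.iterate_add_apply, h1]
      exact annihilatedByHom_iterate_cosyzygyHom R 𝔄 k N h2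
    | add x y hx hy => simp only [iterate_map_add, map_add, hx, hy]
    | neg x hx => simp only [iterate_map_neg, map_neg, hx]
  have hG : ∀ (t : ℕ) (x : InjK0 Λ), g + 1 ≤ t → e ≤ t → (cosyzygyHom R Λ)^[t + d] x =
      (cosyzygyHom R Λ)^[t - e]
        (resCosyzygyHom R 𝔄 he (annihilatedByHom 𝔄 ((cosyzygyHom R Λ)^[d] x))) := by
    intro t x hgt het
    induction x using InjK0.induction_on with
    | mk M =>
      obtain ⟨N, _, _, _, h1, h2⟩ := hN M
      rw [Function.iterate_add_apply, h1]
      exact iterate_cosyzygyHom_eq_resCosyzygyHom R h𝔄 hP hg he N h2 hgt het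
    | add x y hx hy => simp only [iterate_map_add, map_add, hx, hy]
    | neg x hx => simp only [iterate_map_neg, map_neg, hx]
  refine phiRDim_le_of_iterate_eq_zero R fun s hs x hx => ?_
  obtain ⟨t, rfl⟩ := Nat.exists_eq_add_of_le' ((Nat.le_add_right _ _).trans hs)
  have hgt : g + 1 ≤ t := by omega
  have het : e + p ≤ t := by omega
  -- Applying F to Ω⁻⁽ᵗ⁺¹⁺ᵈ⁾x = 0 shows that F(Ω⁻ᵈx) is killed by some iterate over Λ/𝔄, hence by
  -- the p-th.
  have hy := hF (t + 1) x
  rw [add_right_comm, hx, map_zero] at hy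
  have hy' := iterate_cosyzygyHom_eq_zero_of_phiRDim_le R hp _ hy.symm
  have hsemi : Function.Semiconj (resCosyzygyHom R 𝔄 he) (cosyzygyHom R (Λ ⧸ 𝔄))
    (cosyzygyHom R Λ) := resCosyzygyHom_cosyzygyHom R 𝔄 he
  -- Of the t - e cosyzygies outside G, p are moved inside, where they kill F(Ω⁻ᵈx); this is where t
  -- ≥ e + p enters.
  rw [hG t x hgt (by omega), show t - e = t - e - p + p by omega, Function.iterate_add_apply,
    ← (hsemi.iterate_right p).eq, hy', map_zero, iterate_map_zero]

end

theorem proposition4p10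
    {R : Type w} [CommRing R] [IsArtinianRing R]
    {Λ : Type u} [Ring Λ] [Algebra R Λ] [Module.Finite R Λ]
    (𝔄 : Ideal Λ) [𝔄.IsTwoSided] (h𝔄 : IsStrongIdempotentIdeal 𝔄)
    (P : Type u) [AddCommGroup P] [Module Λ P] [Module.Finite Λ P] [Module.Projective Λ P]
    (hP : traceIdeal Λ P = 𝔄) :
    phiRDim R Λ ≤ projDim (leftQuotient 𝔄) +
      max (gldim (Module.End Λ P)ᵐᵒᵖ + 1) (projDim (rightQuotient 𝔄) + phiRDim R (Λ ⧸ 𝔄)) := by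
  -- If any of the four invariants is infinite, the right-hand side is ⊤.
  rcases eq_or_ne (projDim (leftQuotient 𝔄)) ⊤ with hd | hd
  · simp [hd]
  rcases eq_or_ne (gldim (Module.End Λ P)ᵐᵒᵖ) ⊤ with hg | hg
  · simp [hg]
  rcases eq_or_ne (projDim (rightQuotient 𝔄)) ⊤ with he | he
  · simp [he]
  rcases eq_or_ne (phiRDim R (Λ ⧸ 𝔄)) ⊤ with hp | hp
  · simp [hp]
  obtain ⟨d, hd⟩ := ENat.ne_top_iff_exists.1 hd
  obtain ⟨g, hg⟩ := ENat.ne_top_iff_exists.1 hg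
  obtain ⟨e, he⟩ := ENat.ne_top_iff_exists.1 he
  obtain ⟨p, hp⟩ := ENat.ne_top_iff_exists.1 hp
  refine (phiRDim_le_of_le R 𝔄 h𝔄 P hP hd.ge hg.ge he.ge hp.ge).trans ?_
  rw [← hd, ← hg, ← he, ← hp]
  push_cast
  exact le_rfl
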